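/- Let $\mathfrak a$ be the ageing algebra, i.e. the complex Lie algebra with basis $e,h,p,q,z$ and brackets $[h,e]=2e$, $[h,p]=p$, $[h,q]=-q$, $[e,q]=p$, $[e,p]=0$, $[p,q]=z$, $z$ central. An $\mathfrak a$-module is a *weight module* if every element of $\mathfrak h=\mathbb C h+\mathbb C z$ acts diagonalizably. It is a *highest* (respectively *lowest*) *weight module* if it is generated by a nonzero common eigenvector of $h$ and $z$ annihilated by $e$ and $p$ (respectively by $q$). For $\dot z\in\mathbb C$ let $R_{\dot z}$ be the unital subalgebra of the first Weyl algebra (the algebra of operators on $\mathbb C[t]$ generated by $t$ and $\frac{d}{dt}$) generated by $t$ and $t^2\frac{d}{dt}$ if $\dot z=0$, and by $t$ and $t\frac{d}{dt}$ if $\dot z\neq0$. For $\dot h\in\mathbb C$ and an $R_{\dot z}$-module $N$, let $N_{\dot z,\dot h}=N\otimes_{\mathbb C}\mathbb C[x,x^{-1}]$ be the $\mathfrak a$-module on which, for $v\in N$ and $i\in\mathbb Z$, $$h(v\otimes x^i)=(\dot h-i)\,v\otimes x^i,\quad z(v\otimes x^i)=\dot z\, v\otimes x^i,\quad q(v\otimes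 x^i)=v\otimes x^{i+1},$$ $$p(v\otimes x^i)=\bigl((P+(i-1)\dot z)v\bigr)\otimes x^{i-1},\quad e(v\otimes x^i)=\bigl((E+(i-2)P+\tfrac{(i-1)(i-2)}2\dot z)v\bigr)\otimes x^{i-2},$$ where $P=t$, $E=t^2\frac{d}{dt}$ if $\dot z=0$, and $P=2\dot z\,t\frac{d}{dt}$, $E=t+\dot z\,t\frac{d}{dt}+2\dot z\,(t\frac{d}{dt})^2$ if $\dot z\ne0$. **Theorem.** Every simple weight $\mathfrak a$-module is isomorphic to one of the following modules: (i) a simple highest or lowest weight module; (ii) the module $Q(\lambda,\dot h)=\mathbb C[x,x^{-1}]$, where $\dot h\in\mathbb C$ and $\lambda\in\mathbb C\setminus\{0\}$, with the action $$zx^i=px^i=0,\quad qx^i=x^{i+1},\quad ex^i=\lambda x^{i-2},\quad hx^i=(\dot h-i)x^i;$$ (iii) the module $Q'(\dot z,\dot h,\lambda)=\mathbb C[x,x^{-1}]$, where $\dot h\in\mathbb C$, $\dot z\in\mathbb C\setminus\{0\}$ and $\lambda\in\mathbb C\setminus\mathbb Z$, with the action $$qx^i=x^{i+1},\quad px^i=\dot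 z(\lambda+i)x^{i-1},\quad zx^i=\dot zx^i,\quad hx^i=(\dot h-i)x^i,\quad ex^i=\tfrac{\dot z}2(\lambda+i)(\lambda+i-1)x^{i-2};$$ (iv) the module $N_{\dot z,\dot h}$, where $\dot z,\dot h\in\mathbb C$ and $N$ is an infinite-dimensional simple $R_{\dot z}$-module. Moreover, all modules listed in (ii), (iii) and (iv) are simple weight $\mathfrak a$-modules. -/

import Mathlib

open scoped TensorProduct LaurentPolynomial Polynomial

universe u

noncomputable section

/-- The ageing algebra: the element with coordinates `(ce, ch, cp, cq, cz)` is
`ce • e + ch • h + cp • p + cq • q + cz • z`. -/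
@[ext]
structure Ageing : Type where
  ce : ℂ
  ch : ℂ
  cp : ℂ
  cq : ℂ
  cz : ℂ

attribute [local instance 100] LieRing.ofAssociativeRing

namespace Ageing

instance : Zero Ageing := ⟨⟨0, 0, 0, 0, 0⟩⟩
instance : Add Ageing :=
  ⟨fun a b => ⟨a.ce + b.ce, a.ch + b.ch, a.cp + b.cp, a.cq + b.cq, a.cz + b.cz⟩⟩
instance : Neg Ageing := ⟨fun a => ⟨-a.ce, -a.ch, -a.cp, -a.cq, -a.cz⟩⟩
instance : SMul ℂ Ageing := ⟨fun c a => ⟨c * a.ce, c * a.ch, c * a.cp, c * a.cq, c * a.cz⟩⟩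

/-- The bilinear extension of
`[h,e] = 2e`, `[h,p] = p`, `[h,q] = -q`, `[e,q] = p`, `[e,p] = 0`, `[p,q] = z`, `z` central. -/
instance : Bracket Ageing Ageing where
  bracket a b :=
    { ce := 2 * (a.ch * b.ce - a.ce * b.ch)
      ch := 0
      cp := (a.ch * b.cp - a.cp * b.ch) + (a.ce * b.cq - a.cq * b.ce)
      cq := -(a.ch * b.cq - a.cq * b.ch)
      cz := a.cp * b.cq - a.cq * b.cp }

@[simp] theorem ce_zero : (0 : Ageing).ce = 0 := rfl
@[simp] theorem ch_zero : (0 : Ageing).ch = 0 := rfl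
@[simp] theorem cp_zero : (0 : Ageing).cp = 0 := rfl
@[simp] theorem cq_zero : (0 : Ageing).cq = 0 := rfl
@[simp] theorem cz_zero : (0 : Ageing).cz = 0 := rfl
@[simp] theorem ce_add (a b : Ageing) : (a + b).ce = a.ce + b.ce := rfl
@[simp] theorem ch_add (a b : Ageing) : (a + b).ch = a.ch + b.ch := rfl
@[simp] theorem cp_add (a b : Ageing) : (a + b).cp = a.cp + b.cp := rfl
@[simp] theorem cq_add (a b : Ageing) : (a + b).cq = a.cq + b.cq := rfl
@[simp] theorem cz_add (a b : Ageing) : (a + b).cz = a.cz + b.cz := rfl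
@[simp] theorem ce_neg (a : Ageing) : (-a).ce = -a.ce := rfl
@[simp] theorem ch_neg (a : Ageing) : (-a).ch = -a.ch := rfl
@[simp] theorem cp_neg (a : Ageing) : (-a).cp = -a.cp := rfl
@[simp] theorem cq_neg (a : Ageing) : (-a).cq = -a.cq := rfl
@[simp] theorem cz_neg (a : Ageing) : (-a).cz = -a.cz := rfl
@[simp] theorem ce_smul (c : ℂ) (a : Ageing) : (c • a).ce = c * a.ce := rfl
@[simp] theorem ch_smul (c : ℂ) (a : Ageing) : (c • a).ch = c * a.ch := rfl
@[simp] theorem cp_smul (c : ℂ) (a : Ageing) : (c • a).cp = c * a.cp := rfl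
@[simp] theorem cq_smul (c : ℂ) (a : Ageing) : (c • a).cq = c * a.cq := rfl
@[simp] theorem cz_smul (c : ℂ) (a : Ageing) : (c • a).cz = c * a.cz := rfl
@[simp] theorem ce_lie (a b : Ageing) : ⁅a, b⁆.ce = 2 * (a.ch * b.ce - a.ce * b.ch) := rfl
@[simp] theorem ch_lie (a b : Ageing) : ⁅a, b⁆.ch = 0 := rfl
@[simp] theorem cp_lie (a b : Ageing) :
    ⁅a, b⁆.cp = (a.ch * b.cp - a.cp * b.ch) + (a.ce * b.cq - a.cq * b.ce) := rfl
@[simp] theorem cq_lie (a b : Ageing) : ⁅a, b⁆.cq = -(a.ch * b.cq - a.cq * b.ch) := rfl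
@[simp] theorem cz_lie (a b : Ageing) : ⁅a, b⁆.cz = a.cp * b.cq - a.cq * b.cp := rfl

instance : AddCommGroup Ageing where
  add_assoc a b c := by ext <;> simp <;> ring
  zero_add a := by ext <;> simp
  add_zero a := by ext <;> simp
  add_comm a b := by ext <;> simp <;> ring
  neg_add_cancel a := by ext <;> simp
  nsmul := nsmulRec
  zsmul := zsmulRec

instance : Module ℂ Ageing where
  one_smul a := by ext <;> simp
  mul_smul c d a := by ext <;> simp <;> ring
  smul_zero c := by ext <;> simp
  smul_add c a b := by ext <;> simp <;> ring
  add_smul c d a := by ext <;> simp <;> ring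
  zero_smul a := by ext <;> simp

instance : LieRing Ageing where
  add_lie a b c := by ext <;> simp <;> ring
  lie_add a b c := by ext <;> simp <;> ring
  lie_self a := by ext <;> simp <;> ring
  leibniz_lie a b c := by ext <;> simp <;> ring

instance : LieAlgebra ℂ Ageing where
  lie_smul c a b := by ext <;> simp <;> ring

/-- The basis element `e`. -/
def e : Ageing := ⟨1, 0, 0, 0, 0⟩
/-- The basis element `h`. -/
def h : Ageing := ⟨0, 1, 0, 0, 0⟩
/-- The basis element `p`. -/
def p : Ageing := ⟨0, 0, 1, 0, 0⟩
/-- The basis element `q`. -/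
def q : Ageing := ⟨0, 0, 0, 1, 0⟩
/-- The basis element `z`. -/
def z : Ageing := ⟨0, 0, 0, 0, 1⟩

theorem lie_h_e : ⁅h, e⁆ = (2 : ℂ) • e := by ext <;> simp [h, e]
theorem lie_h_p : ⁅h, p⁆ = p := by ext <;> simp [h, p]
theorem lie_h_q : ⁅h, q⁆ = -q := by ext <;> simp [h, q]
theorem lie_e_q : ⁅e, q⁆ = p := by ext <;> simp [e, p, q]
theorem lie_e_p : ⁅e, p⁆ = 0 := by ext <;> simp [e, p]
theorem lie_p_q : ⁅p, q⁆ = z := by ext <;> simp [p, q, z]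
theorem lie_z (a : Ageing) : ⁅z, a⁆ = 0 := by ext <;> simp [z]

/-- Five operators that satisfy the defining relations give a representation. -/
def rep {M : Type*} [AddCommGroup M] [Module ℂ M] (E H P Q Z : Module.End ℂ M)
    (hHE : H * E - E * H = (2 : ℂ) • E) (hHP : H * P - P * H = P) (hHQ : H * Q - Q * H = -Q)
    (hEQ : E * Q - Q * E = P) (hEP : E * P - P * E = 0) (hPQ : P * Q - Q * P = Z)
    (hZE : Z * E = E * Z) (hZH : Z * H = H * Z) (hZP : Z * P = P * Z) (hZQ : Z * Q = Q * Z) :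
    Ageing →ₗ⁅ℂ⁆ Module.End ℂ M where
  toFun a := a.ce • E + a.ch • H + a.cp • P + a.cq • Q + a.cz • Z
  map_add' a b := by simp only [ce_add, ch_add, cp_add, cq_add, cz_add]; module
  map_smul' c a := by
    simp only [ce_smul, ch_smul, cp_smul, cq_smul, cz_smul, RingHom.id_apply]; module
  map_lie' := by
    intro a b
    have h1 : H * E = E * H + (2 : ℂ) • E := by rw [← hHE]; abel
    have h2 : H * P = P * H + P := by nth_rw 3 [← hHP]; abel
    have h3 : Q * H = H * Q + Q := by
      rw [sub_eq_iff_eq_add.1 hHQ]; abel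
    have h4 : E * Q = Q * E + P := by rw [← hEQ]; abel
    have h5 : E * P = P * E := sub_eq_zero.1 hEP
    have h6 : P * Q = Q * P + Z := by rw [← hPQ]; abel
    simp only [ce_lie, ch_lie, cp_lie, cq_lie, cz_lie, LieRing.of_associative_ring_bracket, add_mul, mul_add, smul_mul_assoc,
      mul_smul_comm, h1, h2, h3, h4, h5, h6, hZE, hZH, hZP, hZQ]
    module

section Notions

variable (V : Type*) [AddCommGroup V] [Module ℂ V] [LieRingModule Ageing V] [LieModule ℂ Ageing V]

/-- The Cartan subalgebra spanned by `h` and `z`. -/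
def cartan : Submodule ℂ Ageing := Submodule.span ℂ {h, z}

/-- A weight module: every element of the Cartan subalgebra acts diagonalizably. -/
def IsWeightModule : Prop :=
  ∀ a ∈ cartan, ⨆ μ : ℂ, (LieModule.toEnd ℂ Ageing V a).eigenspace μ = ⊤

/-- A highest weight module: it is generated by a nonzero common eigenvector of `h` and `z` that is
annihilated by `e` and `p`. -/
def IsHighestWeightModule : Prop :=
  ∃ (v : V) (hdot zdot : ℂ), v ≠ 0 ∧ ⁅h, v⁆ = hdot • v ∧ ⁅z, v⁆ = zdot • v ∧
    ⁅e, v⁆ = 0 ∧ ⁅p, v⁆ = 0 ∧ LieSubmodule.lieSpan ℂ Ageing {v} = ⊤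

/-- A lowest weight module: it is generated by a nonzero common eigenvector of `h` and `z` that is
annihilated by `q`. -/
def IsLowestWeightModule : Prop :=
  ∃ (v : V) (hdot zdot : ℂ), v ≠ 0 ∧ ⁅h, v⁆ = hdot • v ∧ ⁅z, v⁆ = zdot • v ∧
    ⁅q, v⁆ = 0 ∧ LieSubmodule.lieSpan ℂ Ageing {v} = ⊤

end Notions

/-! ### Operators on Laurent polynomials -/

/-- The operator on `ℂ[x, x⁻¹]` that maps `x ^ i` to `c i • x ^ (i + d)`. -/
def laurentOp (c : ℤ → ℂ) (d : ℤ) : Module.End ℂ ℂ[T;T⁻¹] :=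
  (AddMonoidAlgebra.basis ℤ ℂ).constr ℂ fun i => c i • LaurentPolynomial.T (i + d)

theorem laurentOp_T (c : ℤ → ℂ) (d i : ℤ) :
    laurentOp c d (LaurentPolynomial.T i) = c i • LaurentPolynomial.T (i + d) :=
  (AddMonoidAlgebra.basis ℤ ℂ).constr_basis ℂ _ i

theorem laurent_ext {M : Type*} [AddCommGroup M] [Module ℂ M] {f g : ℂ[T;T⁻¹] →ₗ[ℂ] M}
    (H : ∀ i : ℤ, f (LaurentPolynomial.T i) = g (LaurentPolynomial.T i)) : f = g :=
  (AddMonoidAlgebra.basis ℤ ℂ).ext H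

section Tensor

variable {N : Type*} [AddCommGroup N] [Module ℂ N]

/-- The operator on `N ⊗ ℂ[x, x⁻¹]` that maps `v ⊗ x ^ i` to `A i v ⊗ x ^ (i + d)`. -/
def tensorOp (A : ℤ → Module.End ℂ N) (d : ℤ) : Module.End ℂ (N ⊗[ℂ] ℂ[T;T⁻¹]) :=
  TensorProduct.lift (LinearMap.flip ((AddMonoidAlgebra.basis ℤ ℂ).constr ℂ fun i =>
    (TensorProduct.mk ℂ N ℂ[T;T⁻¹]).flip (LaurentPolynomial.T (i + d)) ∘ₗ A i))

theorem tensorOp_tmul_T (A : ℤ → Module.End ℂ N) (d i : ℤ) (v : N) :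
    tensorOp A d (v ⊗ₜ LaurentPolynomial.T i) = A i v ⊗ₜ LaurentPolynomial.T (i + d) := by
  simp only [tensorOp, TensorProduct.lift.tmul, LinearMap.flip_apply]
  exact congrArg (fun f : N →ₗ[ℂ] N ⊗[ℂ] ℂ[T;T⁻¹] => f v)
    ((AddMonoidAlgebra.basis ℤ ℂ).constr_basis ℂ _ i)

theorem tensor_ext {f g : Module.End ℂ (N ⊗[ℂ] ℂ[T;T⁻¹])}
    (H : ∀ (v : N) (i : ℤ), f (v ⊗ₜ LaurentPolynomial.T i) = g (v ⊗ₜ LaurentPolynomial.T i)) :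
    f = g :=
  TensorProduct.ext (LinearMap.ext fun v => laurent_ext fun i => H v i)

end Tensor

/-! ### The modules `Q(λ, ḣ)` -/

/-- The underlying space `ℂ[x, x⁻¹]` of the module `Q(λ, ḣ)`. -/
def Q (_lam _hdot : ℂ) : Type := ℂ[T;T⁻¹]

namespace Q

variable (lam hdot : ℂ)

instance : AddCommGroup (Q lam hdot) := inferInstanceAs (AddCommGroup ℂ[T;T⁻¹])
instance : Module ℂ (Q lam hdot) := inferInstanceAs (Module ℂ ℂ[T;T⁻¹])

/-- The action `z xⁱ = p xⁱ = 0`, `q xⁱ = xⁱ⁺¹`, `e xⁱ = λ xⁱ⁻²`, `h xⁱ = (ḣ - i) xⁱ`. -/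
def repr : Ageing →ₗ⁅ℂ⁆ Module.End ℂ ℂ[T;T⁻¹] :=
  Ageing.rep (laurentOp (fun _ => lam) (-2)) (laurentOp (fun i => hdot - i) 0) 0
    (laurentOp (fun _ => 1) 1) 0
    (laurent_ext fun i => by
      simp [laurentOp_T, smul_smul, ← sub_smul]; congr 1; ring)
    (by simp)
    (laurent_ext fun i => by
      simp [laurentOp_T, ← sub_smul])
    (laurent_ext fun i => by
      simp [laurentOp_T, add_right_comm])
    (by simp) (by simp) (by simp) (by simp) (by simp) (by simp)

instance : LieRingModule Ageing (Q lam hdot) :=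
  LieRingModule.compLieHom (L₂ := Module.End ℂ ℂ[T;T⁻¹]) ℂ[T;T⁻¹] (repr lam hdot)
instance : LieModule ℂ Ageing (Q lam hdot) :=
  LieModule.compLieHom (L₂ := Module.End ℂ ℂ[T;T⁻¹]) ℂ[T;T⁻¹] (repr lam hdot)

end Q

/-! ### The modules `Q'(ż, ḣ, λ)` -/

/-- The underlying space `ℂ[x, x⁻¹]` of the module `Q'(ż, ḣ, λ)`. -/
def Q' (_zdot _hdot _lam : ℂ) : Type := ℂ[T;T⁻¹]

namespace Q'

variable (zdot hdot lam : ℂ)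

instance : AddCommGroup (Q' zdot hdot lam) := inferInstanceAs (AddCommGroup ℂ[T;T⁻¹])
instance : Module ℂ (Q' zdot hdot lam) := inferInstanceAs (Module ℂ ℂ[T;T⁻¹])

/-- The action `q xⁱ = xⁱ⁺¹`, `p xⁱ = ż(λ+i) xⁱ⁻¹`, `z xⁱ = ż xⁱ`, `h xⁱ = (ḣ - i) xⁱ`,
`e xⁱ = ż/2 (λ+i)(λ+i-1) xⁱ⁻²`. -/
def repr : Ageing →ₗ⁅ℂ⁆ Module.End ℂ ℂ[T;T⁻¹] :=
  Ageing.rep (laurentOp (fun i => zdot / 2 * (lam + i) * (lam + i - 1)) (-2))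
    (laurentOp (fun i => hdot - i) 0)
    (laurentOp (fun i => zdot * (lam + i)) (-1))
    (laurentOp (fun _ => 1) 1) (laurentOp (fun _ => zdot) 0)
    (laurent_ext fun i => by
      simp [laurentOp_T, smul_smul, ← sub_smul]; congr 1; ring)
    (laurent_ext fun i => by
      simp [laurentOp_T, smul_smul, ← sub_smul]; congr 1; ring)
    (laurent_ext fun i => by
      simp [laurentOp_T, ← sub_smul])
    (laurent_ext fun i => by
      simp only [LinearMap.sub_apply, Module.End.mul_apply, laurentOp_T, map_smul, smul_smul,
        show i + 1 + (-2) = i + (-1) by ring, show i + (-2) + 1 = i + (-1) by ring, ← sub_smul]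
      congr 1; push_cast; ring)
    (laurent_ext fun i => by
      simp only [LinearMap.sub_apply, Module.End.mul_apply, laurentOp_T, map_smul, smul_smul,
        show i + (-1) + (-2) = i + (-3) by ring, show i + (-2) + (-1) = i + (-3) by ring,
        ← sub_smul, LinearMap.zero_apply]
      rw [show ∀ a : ℂ, a = 0 → a • (LaurentPolynomial.T (i + (-3)) : ℂ[T;T⁻¹]) = 0 from
        fun a ha => by rw [ha, zero_smul]]
      push_cast; ring)
    (laurent_ext fun i => by
      simp [laurentOp_T, smul_smul, ← sub_smul]; congr 1; ring)
    (laurent_ext fun i => by simp [laurentOp_T, smul_smul]; congr 1; ring)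
    (laurent_ext fun i => by simp [laurentOp_T, smul_smul]; congr 1; ring)
    (laurent_ext fun i => by simp [laurentOp_T, smul_smul]; congr 1; ring)
    (laurent_ext fun i => by simp [laurentOp_T])

instance : LieRingModule Ageing (Q' zdot hdot lam) :=
  LieRingModule.compLieHom (L₂ := Module.End ℂ ℂ[T;T⁻¹]) ℂ[T;T⁻¹] (repr zdot hdot lam)
instance : LieModule ℂ Ageing (Q' zdot hdot lam) :=
  LieModule.compLieHom (L₂ := Module.End ℂ ℂ[T;T⁻¹]) ℂ[T;T⁻¹] (repr zdot hdot lam)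

end Q'

/-! ### The Weyl algebra and its subalgebras `R_ż` -/

/-- Multiplication by `t` on `ℂ[t]`. -/
def mulT : Module.End ℂ ℂ[X] := LinearMap.mulLeft ℂ Polynomial.X

/-- The operator `d/dt` on `ℂ[t]`. -/
def ddt : Module.End ℂ ℂ[X] := Polynomial.derivative

/-- The first Weyl algebra, as an algebra of operators on `ℂ[t]`. -/
def weylAlgebra : Subalgebra ℂ (Module.End ℂ ℂ[X]) := Algebra.adjoin ℂ {mulT, ddt}

theorem ddt_mul_mulT : ddt * mulT = mulT * ddt + 1 := by
  refine LinearMap.ext fun f => ?_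
  simp [ddt, mulT, add_comm]

open Classical in
/-- The operator `t² d/dt` if `ż = 0`, and `t d/dt` if `ż ≠ 0`. -/
def thetaOp (zdot : ℂ) : Module.End ℂ ℂ[X] :=
  if zdot = 0 then mulT ^ 2 * ddt else mulT * ddt

/-- The algebra `R_ż`: the unital algebra `⟨t, t² d/dt⟩` if `ż = 0`, and `⟨t, t d/dt⟩` if
`ż ≠ 0`. -/
def R (zdot : ℂ) : Subalgebra ℂ (Module.End ℂ ℂ[X]) := Algebra.adjoin ℂ {mulT, thetaOp zdot}

theorem R_zero : R 0 = Algebra.adjoin ℂ {mulT, mulT ^ 2 * ddt} := by simp [R, thetaOp]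

theorem R_of_ne_zero {zdot : ℂ} (hz : zdot ≠ 0) : R zdot = Algebra.adjoin ℂ {mulT, mulT * ddt} := by
  simp [R, thetaOp, hz]

theorem R_le_weylAlgebra (zdot : ℂ) : R zdot ≤ weylAlgebra := by
  have h1 : mulT ∈ weylAlgebra := Algebra.subset_adjoin (by simp)
  have h2 : ddt ∈ weylAlgebra := Algebra.subset_adjoin (by simp)
  refine Algebra.adjoin_le ?_
  rintro a (rfl | rfl)
  · exact h1
  · simp only [thetaOp]
    split_ifs
    · exact mul_mem (pow_mem h1 2) h2
    · exact mul_mem h1 h2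

/-- The generator `t` of `R_ż`. -/
def tR (zdot : ℂ) : R zdot := ⟨mulT, Algebra.subset_adjoin (by simp)⟩

/-- The generator `t² d/dt` (if `ż = 0`) or `t d/dt` (if `ż ≠ 0`) of `R_ż`. -/
def thetaR (zdot : ℂ) : R zdot := ⟨thetaOp zdot, Algebra.subset_adjoin (by simp)⟩

theorem thetaR_mul_tR_zero : thetaR 0 * tR 0 = tR 0 * thetaR 0 + tR 0 ^ 2 := by
  apply Subtype.ext
  change thetaOp 0 * mulT = mulT * thetaOp 0 + mulT ^ 2
  rw [thetaOp, if_pos rfl, mul_assoc, ddt_mul_mulT]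
  noncomm_ring

theorem thetaR_mul_tR {zdot : ℂ} (hz : zdot ≠ 0) :
    thetaR zdot * tR zdot = tR zdot * thetaR zdot + tR zdot := by
  apply Subtype.ext
  change thetaOp zdot * mulT = mulT * thetaOp zdot + mulT
  rw [thetaOp, if_neg hz, mul_assoc, ddt_mul_mulT]
  noncomm_ring

open Classical in
/-- The image of `pq` in `R_ż`: `t` if `ż = 0`, and `2ż t d/dt` if `ż ≠ 0`. -/
def phiPQ (zdot : ℂ) : R zdot := if zdot = 0 then tR zdot else (2 * zdot) • thetaR zdot

open Classical in
/-- The image of `eq²` in `R_ż`: `t² d/dt` if `ż = 0`, and `t + ż t d/dt + 2ż (t d/dt)²` if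
`ż ≠ 0`. -/
def phiEQQ (zdot : ℂ) : R zdot :=
  if zdot = 0 then thetaR zdot
  else tR zdot + zdot • thetaR zdot + (2 * zdot) • thetaR zdot ^ 2

theorem phi_relation (zdot : ℂ) :
    phiEQQ zdot * phiPQ zdot = phiPQ zdot * phiEQQ zdot +
      ((-2 * zdot) • phiEQQ zdot + zdot • phiPQ zdot + phiPQ zdot * phiPQ zdot) := by
  by_cases hz : zdot = 0
  · subst hz
    simp [phiEQQ, phiPQ, thetaR_mul_tR_zero, pow_two]
  · have H := thetaR_mul_tR hz
    simp only [phiEQQ, phiPQ, if_neg hz, add_mul, mul_add, smul_mul_assoc, mul_smul_comm, H,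
      pow_two]
    rw [mul_assoc]
    module

/-! ### The modules `N_{ż, ḣ}` -/

/-- The underlying space `N ⊗ ℂ[x, x⁻¹]` of the module `N_{ż, ḣ}`. -/
def NMod (_zdot _hdot : ℂ) (N : Type*) [AddCommGroup N] [Module ℂ N] : Type _ := N ⊗[ℂ] ℂ[T;T⁻¹]

namespace NMod

variable (zdot hdot : ℂ) (N : Type*) [AddCommGroup N] [Module ℂ N]

instance : AddCommGroup (NMod zdot hdot N) := inferInstanceAs (AddCommGroup (N ⊗[ℂ] ℂ[T;T⁻¹]))
instance : Module ℂ (NMod zdot hdot N) := inferInstanceAs (Module ℂ (N ⊗[ℂ] ℂ[T;T⁻¹]))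

variable [Module (R zdot) N] [IsScalarTower ℂ (R zdot) N]

/-- The action of an element of `R_ż` on `N`, as a `ℂ`-linear operator. -/
def act : R zdot →ₐ[ℂ] Module.End ℂ N := Algebra.lsmul ℂ ℂ N

/-- The coefficient operator of `p`: `pq + (i - 1) z`, through the image in `R_ż`. -/
def coeffP (i : ℤ) : Module.End ℂ N :=
  act zdot N (phiPQ zdot) + (((i : ℂ) - 1) * zdot) • 1

/-- The coefficient operator of `e`: `eq² + (i - 2) pq + (i - 1)(i - 2)/2 z`, through the image in
`R_ż`. -/
def coeffE (i : ℤ) : Module.End ℂ N :=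
  act zdot N (phiEQQ zdot) + ((i : ℂ) - 2) • act zdot N (phiPQ zdot)
    + (((i : ℂ) - 1) * (i - 2) / 2 * zdot) • 1

theorem coeffP_sub (i : ℤ) : coeffP zdot N (i + 1) - coeffP zdot N i = zdot • 1 := by
  simp only [coeffP]
  push_cast
  module

theorem coeffE_sub (i : ℤ) : coeffE zdot N (i + 1) - coeffE zdot N i = coeffP zdot N i := by
  simp only [coeffE, coeffP]
  push_cast
  module

theorem coeffE_mul_coeffP (i : ℤ) :
    coeffE zdot N (i - 1) * coeffP zdot N i = coeffP zdot N (i - 2) * coeffE zdot N i := by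
  have H := congrArg (act zdot N) (phi_relation zdot)
  simp only [map_mul, map_add, map_smul] at H
  simp only [coeffE, coeffP, mul_add, add_mul, smul_mul_assoc, mul_smul_comm, mul_one, one_mul, H]
  push_cast
  module

/-- The action `q (v ⊗ xⁱ) = v ⊗ xⁱ⁺¹`, `p (v ⊗ xⁱ) = (pq + (i-1)z) v ⊗ xⁱ⁻¹`,
`e (v ⊗ xⁱ) = (eq² + (i-2)pq + (i-1)(i-2)/2 z) v ⊗ xⁱ⁻²`, `h (v ⊗ xⁱ) = (ḣ - i) v ⊗ xⁱ`,
`z (v ⊗ xⁱ) = ż v ⊗ xⁱ`. -/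
def repr : Ageing →ₗ⁅ℂ⁆ Module.End ℂ (N ⊗[ℂ] ℂ[T;T⁻¹]) :=
  Ageing.rep (tensorOp (coeffE zdot N) (-2)) (tensorOp (fun i => (hdot - i) • 1) 0)
    (tensorOp (coeffP zdot N) (-1)) (tensorOp (fun _ => 1) 1) (tensorOp (fun _ => zdot • 1) 0)
    (tensor_ext fun v i => by
      simp only [LinearMap.sub_apply, Module.End.mul_apply, tensorOp_tmul_T, LinearMap.smul_apply,
        Module.End.one_apply, map_smul, add_zero, TensorProduct.smul_tmul', ← sub_smul,
        ← TensorProduct.sub_tmul]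
      congr 2; push_cast; ring)
    (tensor_ext fun v i => by
      simp only [LinearMap.sub_apply, Module.End.mul_apply, tensorOp_tmul_T, LinearMap.smul_apply,
        Module.End.one_apply, map_smul, add_zero, TensorProduct.smul_tmul', ← sub_smul,
        ← TensorProduct.sub_tmul]
      push_cast
      rw [show hdot - ((i : ℂ) + -1) - (hdot - i) = 1 by ring, one_smul])
    (tensor_ext fun v i => by
      simp only [LinearMap.sub_apply, Module.End.mul_apply, tensorOp_tmul_T, LinearMap.smul_apply,
        Module.End.one_apply, add_zero, ← sub_smul, LinearMap.neg_apply,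
        ← TensorProduct.sub_tmul, ← TensorProduct.neg_tmul]
      push_cast
      rw [show hdot - ((i : ℂ) + 1) - (hdot - i) = -1 by ring, neg_smul, one_smul])
    (tensor_ext fun v i => by
      simp only [LinearMap.sub_apply, Module.End.mul_apply, tensorOp_tmul_T, Module.End.one_apply,
        show i + 1 + (-2) = i + (-1) by ring, show i + (-2) + 1 = i + (-1) by ring,
        ← TensorProduct.sub_tmul, ← coeffE_sub zdot N i])
    (tensor_ext fun v i => by
      simp only [LinearMap.sub_apply, Module.End.mul_apply, tensorOp_tmul_T,
        show i + (-1) + (-2) = i + (-3) by ring, show i + (-2) + (-1) = i + (-3) by ring,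
        ← TensorProduct.sub_tmul, LinearMap.zero_apply]
      have := congrArg (fun f : Module.End ℂ N => f v) (coeffE_mul_coeffP zdot N i)
      simp only [Module.End.mul_apply] at this
      simp only [← sub_eq_add_neg, this, sub_self, TensorProduct.zero_tmul])
    (tensor_ext fun v i => by
      simp only [LinearMap.sub_apply, Module.End.mul_apply, tensorOp_tmul_T, Module.End.one_apply,
        LinearMap.smul_apply, add_neg_cancel_right, neg_add_cancel_right, add_zero,
        ← TensorProduct.sub_tmul]
      have H := congrArg (fun f : Module.End ℂ N => f v) (coeffP_sub zdot N i)
      simp only [LinearMap.sub_apply, LinearMap.smul_apply, Module.End.one_apply] at H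
      rw [H])
    (tensor_ext fun v i => by simp [tensorOp_tmul_T])
    (tensor_ext fun v i => by simp [tensorOp_tmul_T, smul_smul, mul_comm])
    (tensor_ext fun v i => by simp [tensorOp_tmul_T])
    (tensor_ext fun v i => by simp [tensorOp_tmul_T])

instance : LieRingModule Ageing (NMod zdot hdot N) :=
  LieRingModule.compLieHom (L₂ := Module.End ℂ (N ⊗[ℂ] ℂ[T;T⁻¹])) (N ⊗[ℂ] ℂ[T;T⁻¹])
    (repr zdot hdot N)
instance : LieModule ℂ Ageing (NMod zdot hdot N) :=
  LieModule.compLieHom (L₂ := Module.End ℂ (N ⊗[ℂ] ℂ[T;T⁻¹])) (N ⊗[ℂ] ℂ[T;T⁻¹])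
    (repr zdot hdot N)

end NMod

end Ageing

end

noncomputable section

namespace Ageing

/-! ### Eigenvectors in invariant subspaces -/

section Eigen

variable {V : Type*} [AddCommGroup V] [Module ℂ V]

/-! Let V be a simple weight module that is neither highest nor lowest weight. The centre acts by a
scalar c, and q is injective, since its kernel is h-stable and an h-eigenvector in it would be a
lowest weight vector. The heart of the matter is that q is then bijective, so that V is recovered
from any nonzero weight space N = V_μ as the sum of the translates q^i N, and the action of e and p
is determined by the two operators X = pq and Y = eq² on N.

Bijectivity rests on `IsSimpleAction.eq_eigenspace`: while q is only known to be injective, a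
nonzero subspace of a weight space that is stable under X and Y is the whole weight space. The image
of V_(ν+1) under q is such a subspace of V_ν, so it is everything or zero; in the second case
V_(ν+1) = 0 and every vector of V_ν is killed by e and p, hence is zero.

The operators X and Y satisfy one relation (`IsSimpleAction.relation`), the image of which in R_c is
`phi_relation`. As R_c is presented by its two generators and a single relation (`exists_algHom_R`),
N is an R_c-module, and it is simple. If N is infinite-dimensional, V is the module induced from N.
If N is finite-dimensional, a trace argument forces t to act by zero, so N is a line on which θ acts
by a number d; then V is Q(d, μ) for c = 0 and Q'(c, μ, 2d - 1) for c ≠ 0. The exclusion of highest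
weight vectors gives d ≠ 0, respectively 2d - 1 ∉ ℤ.

For the converse, h has distinct eigenvalues on distinct powers of x, so a nonzero submodule
contains a nonzero homogeneous vector. It remains to move up by q and down by e or p. In the induced
module the step down can fail only if pq acts on N by a scalar, which forces N to be
finite-dimensional. -/

theorem exists_eigenvector_of_aeval_eq_zero (f : Module.End ℂ V) (W : Submodule ℂ V)
    (hW : ∀ x ∈ W, f x ∈ W) (n : ℕ) : ∀ (g : ℂ[X]), g ≠ 0 → g.natDegree = n →
      ∀ x ∈ W, x ≠ 0 → Polynomial.aeval f g x = 0 → ∃ y ∈ W, y ≠ 0 ∧ ∃ μ : ℂ, f y = μ • y := by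
  induction n with
  | zero =>
    intro g hg hn x _ hx0 h
    rw [Polynomial.eq_C_of_natDegree_eq_zero hn] at h hg
    simp only [Polynomial.aeval_C, Module.algebraMap_end_apply] at h
    rcases smul_eq_zero.1 h with h | h
    · simp [h] at hg
    · exact absurd h hx0
  | succ n ih =>
    intro g hg hn x hx hx0 h
    obtain ⟨a, ha⟩ := IsAlgClosed.exists_root g
      (fun h0 => by rw [Polynomial.natDegree_eq_zero_iff_degree_le_zero.2 h0.le] at hn; omega)
    obtain ⟨r, rfl⟩ := Polynomial.dvd_iff_isRoot.2 ha
    -- Write g = (X - a) r. Unless x is already an eigenvector, (f - a) x is a nonzero vector of W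
    -- killed by r(f), and r has smaller degree.
    by_cases hfx : f x = a • x
    · exact ⟨x, hx, hx0, a, hfx⟩
    · have hr : r ≠ 0 := right_ne_zero_of_mul hg
      refine ih r hr ?_ (f x - a • x) (W.sub_mem (hW x hx) (W.smul_mem a hx))
        (sub_ne_zero.2 hfx) ?_
      · rw [Polynomial.natDegree_mul (Polynomial.X_sub_C_ne_zero a) hr,
          Polynomial.natDegree_X_sub_C] at hn
        omega
      · rw [mul_comm, map_mul] at h
        simpa using h

/-- A vector is a finite sum of eigenvectors, and products of annihilating polynomials annihilate
sums because polynomials in f commute. This replaces the minimal polynomial, which need not exist in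
infinite dimension. -/
theorem exists_aeval_eq_zero (f : Module.End ℂ V) (hf : ⨆ μ : ℂ, f.eigenspace μ = ⊤) (x : V) :
    ∃ g : ℂ[X], g ≠ 0 ∧ Polynomial.aeval f g x = 0 := by
  have hx : x ∈ ⨆ μ : ℂ, f.eigenspace μ := hf ▸ Submodule.mem_top
  induction hx using Submodule.iSup_induction' with
  | mem μ x hx =>
    refine ⟨Polynomial.X - Polynomial.C μ, Polynomial.X_sub_C_ne_zero μ, ?_⟩
    rw [Module.End.mem_eigenspace_iff] at hx
    simp [hx]
  | zero => exact ⟨1, one_ne_zero, map_zero _⟩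
  | add x y _ _ hx hy =>
    obtain ⟨g, hg, hgx⟩ := hx
    obtain ⟨r, hr, hry⟩ := hy
    refine ⟨g * r, mul_ne_zero hg hr, ?_⟩
    rw [map_add]
    nth_rw 1 [mul_comm]
    simp [hgx, hry]

theorem exists_eigenvector_mem (f : Module.End ℂ V) (hf : ⨆ μ : ℂ, f.eigenspace μ = ⊤)
    (W : Submodule ℂ V) (hW : ∀ x ∈ W, f x ∈ W) (hW0 : W ≠ ⊥) :
    ∃ y ∈ W, y ≠ 0 ∧ ∃ μ : ℂ, f y = μ • y := by
  obtain ⟨x, hx, hx0⟩ := W.ne_bot_iff.1 hW0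
  obtain ⟨g, hg, hgx⟩ := exists_aeval_eq_zero f hf x
  exact exists_eigenvector_of_aeval_eq_zero f W hW _ g hg rfl x hx hx0 hgx

/-- Subspaces of independent subspaces are recovered by intersection with their sum. -/
theorem iSup_inf_eq_of_iSupIndep {ι : Type*} {A B : ι → Submodule ℂ V} (hB : iSupIndep B)
    (hAB : ∀ i, A i ≤ B i) (j : ι) : (⨆ i, A i) ⊓ B j = A j := by
  refine le_antisymm ?_ (le_inf (le_iSup A j) (hAB j))
  have h1 : ⨆ i, A i ≤ A j ⊔ ⨆ (i) (_ : i ≠ j), B i := by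
    refine iSup_le fun i => ?_
    by_cases h : i = j
    · exact h ▸ le_sup_left
    · exact ((hAB i).trans (le_iSup₂_of_le i h le_rfl)).trans le_sup_right
  refine (inf_le_inf_right _ h1).trans ?_
  -- The modular law applies because A j ≤ B j; independence kills what remains of B j.
  rw [sup_inf_assoc_of_le _ (hAB j), inf_comm, (hB j).eq_bot, sup_bot_eq]

/-- The pieces A i may be proper subspaces of the eigenspaces. This is what recovers a prescribed
piece from the mere fact that the pieces sum to the whole space. -/
theorem mem_of_mem_iSup_of_eigenvector {ι : Type*} (f : Module.End ℂ V) {c : ι → ℂ}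
    (hc : Function.Injective c) {A : ι → Submodule ℂ V} (hA : ∀ i, A i ≤ f.eigenspace (c i))
    {j : ι} {x : V} (hx : x ∈ ⨆ i, A i) (hfx : f x = c j • x) : x ∈ A j := by
  rw [← iSup_inf_eq_of_iSupIndep (f.eigenspaces_iSupIndep.comp hc) hA j]
  exact ⟨hx, Module.End.mem_eigenspace_iff.2 hfx⟩

/-- A nonzero invariant subspace of a space graded by eigenspaces contains a nonzero homogeneous
element. -/
theorem exists_homogeneous_mem {ι : Type*} (f : Module.End ℂ V) {c : ι → ℂ}
    (hc : Function.Injective c) {A : ι → Submodule ℂ V} (hA : ∀ i, A i ≤ f.eigenspace (c i))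
    (htop : ⨆ i, A i = ⊤) (W : Submodule ℂ V) (hW : ∀ x ∈ W, f x ∈ W) (hW0 : W ≠ ⊥) :
    ∃ i, ∃ y ∈ W, y ≠ 0 ∧ y ∈ A i := by
  have hf : ⨆ μ : ℂ, f.eigenspace μ = ⊤ :=
    top_le_iff.1 (htop ▸ iSup_le fun i => (hA i).trans (le_iSup _ (c i)))
  obtain ⟨y, hy, hy0, μ, hμ⟩ := exists_eigenvector_mem f hf W hW hW0
  by_cases h : ∃ i, c i = μ
  · obtain ⟨i, rfl⟩ := h
    exact ⟨i, y, hy, hy0, mem_of_mem_iSup_of_eigenvector f hc hA (htop ▸ Submodule.mem_top) hμ⟩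
  · exfalso
    -- If μ is none of the c i, all of V lies in the sum of the other eigenspaces, which is
    -- independent of the μ-eigenspace.
    have h1 : (⊤ : Submodule ℂ V) ≤ ⨆ (ν : ℂ) (_ : ν ≠ μ), f.eigenspace ν :=
      htop ▸ iSup_le fun i => (hA i).trans
        (le_iSup₂_of_le (c i) (fun hi => h ⟨i, hi⟩) le_rfl)
    refine hy0 (Submodule.disjoint_def.1 (f.eigenspaces_iSupIndep μ) y
      (Module.End.mem_eigenspace_iff.2 hμ) (h1 Submodule.mem_top))

end Eigen

/-! ### The presentation of `R_ż` -/

section Presentation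

variable {A : Type*} [Ring A] [Algebra ℂ A] {τ η : A} {k : ℕ}

theorem mul_pow_eq_of_mul_eq (h : η * τ = τ * η + τ ^ (k + 1)) (i : ℕ) :
    η * τ ^ i = τ ^ i * η + (i : ℂ) • τ ^ (i + k) := by
  induction i with
  | zero => simp
  | succ i ih =>
    rw [pow_succ, ← mul_assoc, ih, add_mul, mul_assoc, h, mul_add, ← mul_assoc, ← pow_add,
      smul_mul_assoc, ← pow_succ, ← pow_succ, Nat.cast_succ, add_smul, one_smul,
      show i + (k + 1) = i + 1 + k by omega, show i + k + 1 = i + 1 + k by omega]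
    abel

theorem adjoin_le_span_monomials (h : η * τ = τ * η + τ ^ (k + 1)) {x : A}
    (hx : x ∈ Algebra.adjoin ℂ {τ, η}) :
    x ∈ Submodule.span ℂ (Set.range fun a : ℕ × ℕ => τ ^ a.1 * η ^ a.2) := by
  set M := Submodule.span ℂ (Set.range fun a : ℕ × ℕ => τ ^ a.1 * η ^ a.2) with hM
  have hmem (i j : ℕ) : τ ^ i * η ^ j ∈ M := Submodule.subset_span ⟨(i, j), rfl⟩
  -- Stability of the span under left multiplication is the statement that passes through products
  -- in the induction; it is evaluated at s = 1 at the end.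
  have key : ∀ s ∈ M, x * s ∈ M := by
    induction hx using Algebra.adjoin_induction with
    | mem x hx =>
      intro s hs
      induction hs using Submodule.span_induction with
      | mem s hs =>
        obtain ⟨⟨i, j⟩, rfl⟩ := hs
        rcases hx with rfl | rfl
        · simpa only [← mul_assoc, ← pow_succ'] using hmem (i + 1) j
        · simp only [← mul_assoc, mul_pow_eq_of_mul_eq h, add_mul, smul_mul_assoc]
          refine add_mem ?_ (M.smul_mem _ (hmem _ _))
          simpa only [mul_assoc, ← pow_succ'] using hmem i (j + 1)
      | zero => simp
      | add s t _ _ hs ht => rw [mul_add]; exact add_mem hs ht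
      | smul c s _ hs => rw [mul_smul_comm]; exact M.smul_mem c hs
    | algebraMap r =>
      intro s hs
      rw [← Algebra.smul_def]
      exact M.smul_mem r hs
    | add x y _ _ hx hy => intro s hs; rw [add_mul]; exact add_mem (hx s hs) (hy s hs)
    | mul x y _ _ hx hy => intro s hs; rw [mul_assoc]; exact hx _ (hy s hs)
  simpa using key 1 (by simpa using hmem 0 0)

end Presentation

/-! ### Linear independence of the ordered monomials in R_ż, and its presentation. -/

theorem mulT_apply (f : ℂ[X]) : mulT f = Polynomial.X * f := rfl

theorem mulT_pow_apply (i : ℕ) (f : ℂ[X]) : (mulT ^ i) f = Polynomial.X ^ i * f := by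
  induction i with
  | zero => simp
  | succ i ih => rw [pow_succ', Module.End.mul_apply, ih, mulT_apply, pow_succ', mul_assoc]

theorem mulT_pow_mul_ddt_apply_X_pow (k n : ℕ) :
    (mulT ^ (k + 1) * ddt) (Polynomial.X ^ n) = (n : ℂ) • Polynomial.X ^ (n + k) := by
  rw [Module.End.mul_apply, mulT_pow_apply, ddt, Polynomial.derivative_X_pow]
  cases n with
  | zero => simp
  | succ n =>
    rw [Polynomial.smul_eq_C_mul, Nat.add_sub_cancel]
    ring

/-- Monomials in `t` and an operator with `θ ^ j t ^ n = a_j(n) t ^ (n + k j)`, where `a_j` is a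
polynomial of degree `j`, are linearly independent. -/
theorem linearIndependent_monomials (θ : Module.End ℂ ℂ[X]) (k : ℕ) (S : Polynomial.Sequence ℂ)
    (h : ∀ j n : ℕ, (θ ^ j) (Polynomial.X ^ n) =
      ((S j).eval (n : ℂ)) • Polynomial.X ^ (n + k * j)) :
    LinearIndependent ℂ fun a : ℕ × ℕ => mulT ^ a.1 * θ ^ a.2 := by
  rw [linearIndependent_iff']
  intro s c hc ⟨i₀, j₀⟩ ha
  classical
  set m := i₀ + k * j₀ with hm
  set s' := s.filter fun a => a.1 + k * a.2 = m with hs'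
  -- On the line i + k j = m the exponent j determines i, so the S j that occur have pairwise
  -- distinct degrees.
  have hS : LinearIndepOn ℂ (fun a : ℕ × ℕ => S a.2) (s' : Set (ℕ × ℕ)) := by
    refine S.linearIndependent.comp (fun a : (s' : Set (ℕ × ℕ)) => a.1.2) ?_
    rintro ⟨⟨i, j⟩, h1⟩ ⟨⟨i', j'⟩, h2⟩ h3
    simp only [hs', Finset.coe_filter, Set.mem_ofPred_eq] at h1 h2 h3
    subst h3
    obtain rfl : i = i' := by omega
    rfl
  refine linearIndepOn_finset_iff.1 hS c ?_ (i₀, j₀) (by simp [hs', ha, hm])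
  refine Polynomial.eq_zero_of_infinite_isRoot _
    ((Set.infinite_range_of_injective (Nat.cast_injective (R := ℂ))).mono ?_)
  rintro _ ⟨n, rfl⟩
  -- Applying the relation to t ^ n and reading the coefficient of t ^ (n + m) isolates the
  -- monomials on that line. This holds for every n, so the polynomial Σ c_a S_j has infinitely many
  -- roots.
  have hn := congrArg (fun f : Module.End ℂ ℂ[X] => (f (Polynomial.X ^ n)).coeff (n + m)) hc
  simp only [LinearMap.sum_apply, LinearMap.smul_apply, Module.End.mul_apply, h, map_smul,
    mulT_pow_apply, ← pow_add, Polynomial.finsetSum_coeff, Polynomial.coeff_smul,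
    Polynomial.coeff_X_pow, LinearMap.zero_apply, Polynomial.coeff_zero] at hn
  simp only [Set.mem_ofPred_eq, Polynomial.IsRoot.def, Polynomial.eval_finsetSum,
    Polynomial.eval_smul]
  rw [← hn, hs', Finset.sum_filter]
  refine Finset.sum_congr rfl fun a _ => ?_
  have : n + m = a.1 + (n + k * a.2) ↔ a.1 + k * a.2 = m := by omega
  simp [this]

/-- The coefficient polynomials are explicit: (t² d/dt)^j t^n = n(n+1)⋯(n+j-1) t^(n+j), a rising
factorial, and (t d/dt)^j t^n = n^j t^n. -/
theorem linearIndependent_monomials_thetaOp (zdot : ℂ) :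
    LinearIndependent ℂ fun a : ℕ × ℕ => mulT ^ a.1 * thetaOp zdot ^ a.2 := by
  by_cases hz : zdot = 0
  · rw [thetaOp, if_pos hz]
    refine linearIndependent_monomials _ 1
      ⟨fun j => ascPochhammer ℂ j, fun j => ?_⟩ fun j n => ?_
    · rw [Polynomial.degree_eq_natDegree (monic_ascPochhammer ℂ j).ne_zero,
        ascPochhammer_natDegree]
    · change _ = (ascPochhammer ℂ j).eval (n : ℂ) • _
      induction j with
      | zero => simp
      | succ j ih =>
        rw [pow_succ', Module.End.mul_apply, ih, map_smul, mulT_pow_mul_ddt_apply_X_pow,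
          smul_smul, ascPochhammer_succ_eval]
        congr 2
        push_cast
        ring
  · rw [thetaOp, if_neg hz]
    refine linearIndependent_monomials _ 0
      ⟨fun j => Polynomial.X ^ j, fun j => Polynomial.degree_X_pow j⟩ fun j n => ?_
    change _ = (Polynomial.X ^ j : ℂ[X]).eval (n : ℂ) • _
    induction j with
    | zero => simp
    | succ j ih =>
      have := mulT_pow_mul_ddt_apply_X_pow 0 n
      rw [zero_add, pow_one, add_zero] at this
      rw [pow_succ', Module.End.mul_apply, ih, map_smul, zero_mul, add_zero, this, smul_smul,
        Polynomial.eval_pow, Polynomial.eval_X, Polynomial.eval_pow, Polynomial.eval_X, pow_succ,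
        zero_mul, add_zero]

open Classical in
/-- The defining relation of `R_ż` is `θ t = t θ + t ^ (relExp + 1)`. -/
def relExp (zdot : ℂ) : ℕ := if zdot = 0 then 1 else 0

theorem thetaR_mul_tR_eq (zdot : ℂ) :
    thetaR zdot * tR zdot = tR zdot * thetaR zdot + tR zdot ^ (relExp zdot + 1) := by
  by_cases hz : zdot = 0
  · subst hz; simpa [relExp] using thetaR_mul_tR_zero
  · simpa [relExp, hz] using thetaR_mul_tR hz

theorem adjoin_pair_coe {A : Type*} [Ring A] [Algebra ℂ A] (a b : A)
    (ha : a ∈ Algebra.adjoin ℂ {a, b}) (hb : b ∈ Algebra.adjoin ℂ {a, b}) :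
    Algebra.adjoin ℂ {(⟨a, ha⟩ : Algebra.adjoin ℂ {a, b}), ⟨b, hb⟩} = ⊤ := by
  rw [← Algebra.adjoin_adjoin_coe_preimage (s := ({a, b} : Set A))]
  congr 1
  ext x
  simp [Subtype.ext_iff]

theorem adjoin_tR_thetaR (zdot : ℂ) : Algebra.adjoin ℂ {tR zdot, thetaR zdot} = ⊤ :=
  adjoin_pair_coe mulT (thetaOp zdot) _ _

theorem linearIndependent_monomials_R (zdot : ℂ) :
    LinearIndependent ℂ fun a : ℕ × ℕ => tR zdot ^ a.1 * thetaR zdot ^ a.2 :=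
  LinearIndependent.of_comp (R zdot).val.toLinearMap (linearIndependent_monomials_thetaOp zdot)

/-- An algebra generated by `t`, `θ` with `θ t = t θ + t ^ (k + 1)` whose monomials `t ^ i θ ^ j` are
linearly independent is presented by this relation. -/
theorem exists_algHom_of_linearIndependent {C A : Type*} [Ring C] [Algebra ℂ C] [Ring A]
    [Algebra ℂ A] {k : ℕ} {t θ : C} {τ η : A} (hC : θ * t = t * θ + t ^ (k + 1))
    (hA : η * τ = τ * η + τ ^ (k + 1)) (hgen : Algebra.adjoin ℂ {t, θ} = ⊤)
    (hind : LinearIndependent ℂ fun a : ℕ × ℕ => t ^ a.1 * θ ^ a.2) :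
    ∃ f : C →ₐ[ℂ] A, f t = τ ∧ f θ = η := by
  have h' : ((θ, η) : C × A) * (t, τ) = (t, τ) * (θ, η) + (t, τ) ^ (k + 1) := Prod.ext hC hA
  -- B is the graph of the desired homomorphism. Its ordered monomials span it, and their first
  -- components are independent, so the first projection is bijective and can be inverted.
  let B : Subalgebra ℂ (C × A) := Algebra.adjoin ℂ {(t, τ), (θ, η)}
  let π₁ : B →ₐ[ℂ] C := (AlgHom.fst ℂ C A).comp B.val
  let π₂ : B →ₐ[ℂ] A := (AlgHom.snd ℂ C A).comp B.val
  let bt : B := ⟨(t, τ), Algebra.subset_adjoin (Or.inl rfl)⟩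
  let bθ : B := ⟨(θ, η), Algebra.subset_adjoin (Or.inr rfl)⟩
  have hinj : Function.Injective π₁ := by
    refine (injective_iff_map_eq_zero π₁).2 fun b hb => ?_
    obtain ⟨c, hc⟩ := Finsupp.mem_span_range_iff_exists_finsupp.1
      (adjoin_le_span_monomials h' b.2)
    have hc0 : c = 0 := by
      refine linearIndependent_iff.1 hind c ?_
      have := congrArg (AlgHom.fst ℂ C A) hc
      simp only [Finsupp.sum, map_sum, map_smul, map_mul, map_pow, AlgHom.fst_apply] at this
      rw [Finsupp.linearCombination_apply, Finsupp.sum]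
      exact this.trans hb
    rw [hc0, Finsupp.sum_zero_index] at hc
    exact Subtype.ext hc.symm
  have hsurj : Function.Surjective π₁ := by
    rw [← AlgHom.range_eq_top, ← top_le_iff, ← hgen]
    refine Algebra.adjoin_le ?_
    rintro x (rfl | rfl)
    · exact ⟨bt, rfl⟩
    · exact ⟨bθ, rfl⟩
  let φ := AlgEquiv.ofBijective π₁ ⟨hinj, hsurj⟩
  have ht : φ.symm t = bt := φ.symm_apply_eq.2 rfl
  have hθ : φ.symm θ = bθ := φ.symm_apply_eq.2 rfl
  refine ⟨π₂.comp φ.symm.toAlgHom, ?_, ?_⟩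
  · change π₂ (φ.symm t) = τ
    rw [ht]; rfl
  · change π₂ (φ.symm θ) = η
    rw [hθ]; rfl

/-- `R_ż` is presented by the generators `t`, `θ` and the relation
`θ t = t θ + t ^ (relExp + 1)`. -/
theorem exists_algHom_R (zdot : ℂ) {A : Type*} [Ring A] [Algebra ℂ A] (τ η : A)
    (h : η * τ = τ * η + τ ^ (relExp zdot + 1)) :
    ∃ f : R zdot →ₐ[ℂ] A, f (tR zdot) = τ ∧ f (thetaR zdot) = η :=
  exists_algHom_of_linearIndependent (C := R zdot) (thetaR_mul_tR_eq zdot) h (adjoin_tR_thetaR zdot)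
    (linearIndependent_monomials_R zdot)

/-! ### Simple representations of `θ t = t θ + t ^ k` -/

section SimplePairs

variable {N : Type*} [AddCommGroup N] [Module ℂ N]

/-- The only subspaces invariant under both operators are the trivial ones. -/
def IsSimplePair (A B : Module.End ℂ N) : Prop :=
  ∀ S : Submodule ℂ N, (∀ v ∈ S, A v ∈ S) → (∀ v ∈ S, B v ∈ S) → S = ⊥ ∨ S = ⊤

/-- With A = 0 this is a simple module over ℂ[B], hence a line. No dimension assumption is made, so
an annihilating polynomial has to be produced by hand, and a root of it gives an eigenvector. -/
theorem IsSimplePair.exists_span_singleton [Nontrivial N] {A B : Module.End ℂ N}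
    (hs : IsSimplePair A B) (hA : A = 0) : ∃ v : N, v ≠ 0 ∧ ∃ c : ℂ, B = c • 1 ∧ ℂ ∙ v = ⊤ := by
  obtain ⟨x, hx⟩ := exists_ne (0 : N)
  have hg : ∃ g : ℂ[X], g ≠ 0 ∧ Polynomial.aeval B g x = 0 := by
    by_cases hB : B = 0
    · exact ⟨Polynomial.X, Polynomial.X_ne_zero, by simp [hB]⟩
    have hker : LinearMap.range B = ⊤ := (hs (LinearMap.range B) (by simp [hA])
      fun v _ => LinearMap.mem_range_self B v).resolve_left
        fun h => hB (LinearMap.range_eq_bot.1 h)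
    obtain ⟨w, rfl⟩ : ∃ w, B w = x := LinearMap.range_eq_top.1 hker x
    have hcyc : LinearMap.range ((LinearMap.applyₗ (B w)) ∘ₗ
        (Polynomial.aeval B : ℂ[X] →ₐ[ℂ] Module.End ℂ N).toLinearMap) = ⊤ := by
      refine (hs _ (fun v _ => by simp [hA]) ?_).resolve_left ?_
      · rintro _ ⟨g, rfl⟩
        exact ⟨Polynomial.X * g, by simp⟩
      · intro h
        have : B w ∈ (⊥ : Submodule ℂ N) := h ▸ ⟨1, by simp⟩
        exact hx ((Submodule.mem_bot ℂ).1 this)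
    obtain ⟨g, hg⟩ := LinearMap.range_eq_top.1 hcyc w
    -- From w = g(B) B w it follows that B g(B) - 1 kills x = B w. The polynomial is nonzero because
    -- its value at 0 is -1.
    refine ⟨Polynomial.X * g - 1, fun h => ?_, ?_⟩
    · have := congrArg (Polynomial.eval 0) h
      simp at this
    · simp only [LinearMap.comp_apply, AlgHom.toLinearMap_apply, LinearMap.applyₗ_apply_apply] at hg
      simp [hg]
  obtain ⟨g, hg0, hg⟩ := hg
  obtain ⟨v, -, hv, c, hc⟩ := exists_eigenvector_of_aeval_eq_zero B ⊤ (fun _ _ => trivial) _ g hg0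
    rfl x trivial hx hg
  have hspan : ℂ ∙ v = ⊤ := by
    refine (hs _ (by simp [hA]) fun w hw => ?_).resolve_left
      (fun h => hv (Submodule.span_singleton_eq_bot.1 h))
    obtain ⟨a, rfl⟩ := Submodule.mem_span_singleton.1 hw
    rw [map_smul, hc]
    exact Submodule.smul_mem _ _ (Submodule.smul_mem _ _ (Submodule.mem_span_singleton_self v))
  refine ⟨v, hv, c, LinearMap.ext fun w => ?_, hspan⟩
  obtain ⟨a, rfl⟩ := Submodule.mem_span_singleton.1 (hspan ▸ Submodule.mem_top : w ∈ ℂ ∙ v)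
  simp [hc, smul_comm a c]

theorem IsSimplePair.finiteDimensional [Nontrivial N] {A B : Module.End ℂ N}
    (hs : IsSimplePair A B) (hA : A = 0) : FiniteDimensional ℂ N := by
  obtain ⟨v, -, -, -, hv⟩ := hs.exists_span_singleton hA
  exact Module.finite_def.2 (hv ▸ Submodule.fg_span_singleton v)

/-- The kernel of A is invariant, so a nonzero A is invertible. The relation then says A⁻¹BA - B = 1
for k = 0 and A⁻¹B - BA⁻¹ = 1 for k = 1; in both cases the left side has trace zero, while the
identity does not. -/
theorem IsSimplePair.eq_zero_of_finiteDimensional [Nontrivial N] [FiniteDimensional ℂ N]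
    {A B : Module.End ℂ N} {k : ℕ} (hs : IsSimplePair A B) (hk : k ≤ 1)
    (hAB : B * A = A * B + A ^ (k + 1)) : A = 0 := by
  by_contra hA
  have hker : LinearMap.ker A = ⊥ := by
    refine (hs (LinearMap.ker A) (fun v hv => ?_) fun v hv => ?_).resolve_right
      (fun h => hA (LinearMap.ker_eq_top.1 h))
    · rw [LinearMap.mem_ker] at hv ⊢
      rw [hv, map_zero]
    · rw [LinearMap.mem_ker] at hv ⊢
      have := congrArg (fun f : Module.End ℂ N => f v) hAB
      simp only [Module.End.mul_apply, LinearMap.add_apply, hv, map_zero, pow_succ,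
        add_zero] at this
      exact this.symm
  obtain ⟨u, rfl⟩ : IsUnit A := (LinearMap.isUnit_iff_ker_eq_bot A).2 hker
  have key (D D' : Module.End ℂ N) (h : D - D' = 1) :
      LinearMap.trace ℂ N D ≠ LinearMap.trace ℂ N D' := by
    intro h'
    have := congrArg (LinearMap.trace ℂ N) h
    rw [map_sub, h', sub_self, LinearMap.trace_one] at this
    exact Module.finrank_pos.ne (by exact_mod_cast this)
  interval_cases k
  · refine key (u⁻¹.1 * (B * u.1)) B ?_ (by rw [LinearMap.trace_mul_comm, mul_assoc]; simp)
    rw [hAB]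
    simp [mul_add]
  · refine key (u⁻¹.1 * B) (B * u⁻¹.1) ?_ (LinearMap.trace_mul_comm _ _ _)
    have h2 := congrArg (fun f => u⁻¹.1 * f * u⁻¹.1) hAB
    simp only [mul_add, add_mul, pow_succ, pow_zero, one_mul, mul_assoc, Units.mul_inv, mul_one,
      Units.inv_mul_cancel_left] at h2
    rw [h2]
    abel

end SimplePairs

/-- The images of pq and eq² generate R_ż: for ż ≠ 0, θ is a multiple of the first, and subtracting
a polynomial in θ from the second leaves t. -/
theorem phiPQ_mem_iff (zdot : ℂ) {N : Type*} [AddCommGroup N] [Module ℂ N]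
    (f : R zdot →ₐ[ℂ] Module.End ℂ N) (S : Submodule ℂ N) :
    ((∀ v ∈ S, f (phiPQ zdot) v ∈ S) ∧ ∀ v ∈ S, f (phiEQQ zdot) v ∈ S) ↔
      (∀ v ∈ S, f (tR zdot) v ∈ S) ∧ ∀ v ∈ S, f (thetaR zdot) v ∈ S := by
  by_cases hz : zdot = 0
  · simp [phiPQ, phiEQQ, hz]
  · have h2 : (2 * zdot) ≠ 0 := mul_ne_zero two_ne_zero hz
    simp only [phiPQ, phiEQQ, hz, if_false, map_add, map_smul, map_mul, LinearMap.add_apply,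
      LinearMap.smul_apply, pow_two, Module.End.mul_apply]
    constructor
    · rintro ⟨h1, h3⟩
      have hθ : ∀ v ∈ S, f (thetaR zdot) v ∈ S := fun v hv => (S.smul_mem_iff h2).1 (h1 v hv)
      refine ⟨fun v hv => ?_, hθ⟩
      have := h3 v hv
      rw [add_assoc] at this
      exact (S.add_mem_iff_left (add_mem (S.smul_mem _ (hθ v hv))
        (S.smul_mem _ (hθ _ (hθ v hv))))).1 this
    · rintro ⟨h1, h3⟩
      exact ⟨fun v hv => S.smul_mem _ (h3 v hv), fun v hv => add_mem (add_mem (h1 v hv)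
        (S.smul_mem _ (h3 v hv))) (S.smul_mem _ (h3 _ (h3 v hv)))⟩

/-! ### Simple R_ż-modules as simple pairs of operators. -/

section RModules

variable (zdot : ℂ) (N : Type*) [AddCommGroup N] [Module ℂ N] [Module (R zdot) N]
  [IsScalarTower ℂ (R zdot) N]

theorem smul_mem_of_tR_thetaR (S : Submodule ℂ N) (h1 : ∀ v ∈ S, tR zdot • v ∈ S)
    (h2 : ∀ v ∈ S, thetaR zdot • v ∈ S) (r : R zdot) : ∀ v ∈ S, r • v ∈ S := by
  have hr : r ∈ Algebra.adjoin ℂ {tR zdot, thetaR zdot} := adjoin_tR_thetaR zdot ▸ trivial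
  induction hr using Algebra.adjoin_induction with
  | mem x hx =>
    rcases hx with rfl | rfl
    · exact h1
    · exact h2
  | algebraMap c => intro v hv; rw [algebraMap_smul]; exact S.smul_mem c hv
  | add x y _ _ hx hy => intro v hv; rw [add_smul]; exact add_mem (hx v hv) (hy v hv)
  | mul x y _ _ hx hy => intro v hv; rw [mul_smul]; exact hx _ (hy v hv)

theorem isSimplePair_of_isSimpleModule [IsSimpleModule (R zdot) N] :
    IsSimplePair (NMod.act zdot N (tR zdot)) (NMod.act zdot N (thetaR zdot)) := by
  intro S h1 h2
  let S' : Submodule (R zdot) N :=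
    { S with smul_mem' := fun r v hv => smul_mem_of_tR_thetaR zdot N S h1 h2 r v hv }
  have hS (v : N) : v ∈ S' ↔ v ∈ S := Iff.rfl
  have := (isSimpleModule_iff (R zdot) N).1 inferInstance
  rcases eq_bot_or_eq_top S' with h | h
  · left
    ext v
    rw [← hS, h]; rfl
  · right
    ext v
    rw [← hS, h]; simp

theorem isSimpleModule_of_isSimplePair [Nontrivial N]
    (h : IsSimplePair (NMod.act zdot N (tR zdot)) (NMod.act zdot N (thetaR zdot))) :
    IsSimpleModule (R zdot) N := by
  rw [isSimpleModule_iff]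
  refine { eq_bot_or_eq_top := fun S => ?_ }
  have hS (v : N) : v ∈ S.restrictScalars ℂ ↔ v ∈ S := Iff.rfl
  rcases h (S.restrictScalars ℂ) (fun v hv => S.smul_mem _ hv) (fun v hv => S.smul_mem _ hv)
    with h | h
  · left
    ext v
    rw [← hS, h]; rfl
  · right
    ext v
    rw [← hS, h]; simp

/-- In either case t acts by zero: for ż = 0 it is pq itself, and for ż ≠ 0 the element θ acts by a
scalar, so θt = tθ + t gives t = 0. -/
theorem finiteDimensional_of_phiPQ_eq_smul [IsSimpleModule (R zdot) N] (i : ℂ)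
    (h : NMod.act zdot N (phiPQ zdot) = (i * zdot) • 1) : FiniteDimensional ℂ N := by
  have := IsSimpleModule.nontrivial (R zdot) N
  refine (isSimplePair_of_isSimpleModule zdot N).finiteDimensional ?_
  by_cases hz : zdot = 0
  · subst hz
    simpa [phiPQ] using h
  · have hθ : NMod.act zdot N (thetaR zdot) = (i / 2) • 1 := by
      rw [phiPQ, if_neg hz, map_smul] at h
      have h2 : (2 * zdot) ≠ 0 := mul_ne_zero two_ne_zero hz
      rw [← inv_smul_smul₀ h2 (NMod.act zdot N (thetaR zdot)), h, smul_smul]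
      congr 1
      field_simp
    have := congrArg (NMod.act zdot N) (thetaR_mul_tR hz)
    rw [map_mul, map_add, map_mul, hθ] at this
    simpa using this

end RModules

/-! ### Modules over the ageing algebra through the five basis elements -/

section Generators

variable {V : Type*} [AddCommGroup V] [Module ℂ V] [LieRingModule Ageing V] [LieModule ℂ Ageing V]
  {V' : Type*} [AddCommGroup V'] [Module ℂ V'] [LieRingModule Ageing V'] [LieModule ℂ Ageing V']

theorem eq_sum_basis (a : Ageing) :
    a = a.ce • e + a.ch • h + a.cp • p + a.cq • q + a.cz • z := by
  ext <;> simp [e, h, p, q, z]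

theorem lie_eq_sum (a : Ageing) (v : V) :
    ⁅a, v⁆ = a.ce • ⁅e, v⁆ + a.ch • ⁅h, v⁆ + a.cp • ⁅p, v⁆ + a.cq • ⁅q, v⁆ + a.cz • ⁅z, v⁆ := by
  conv_lhs => rw [eq_sum_basis a]
  simp only [add_lie, smul_lie]

/-- A subspace stable under the five basis elements is a submodule. -/
def lieSubmoduleOfStable (S : Submodule ℂ V) (he : ∀ v ∈ S, ⁅e, v⁆ ∈ S) (hh : ∀ v ∈ S, ⁅h, v⁆ ∈ S)
    (hp : ∀ v ∈ S, ⁅p, v⁆ ∈ S) (hq : ∀ v ∈ S, ⁅q, v⁆ ∈ S) (hz : ∀ v ∈ S, ⁅z, v⁆ ∈ S) :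
    LieSubmodule ℂ Ageing V :=
  { S with
    lie_mem := by
      intro a v hv
      rw [lie_eq_sum]
      exact add_mem (add_mem (add_mem (add_mem (S.smul_mem _ (he v hv)) (S.smul_mem _ (hh v hv)))
        (S.smul_mem _ (hp v hv))) (S.smul_mem _ (hq v hv))) (S.smul_mem _ (hz v hv)) }

theorem eq_bot_or_eq_top_of_stable [LieModule.IsIrreducible ℂ Ageing V] (S : Submodule ℂ V)
    (he : ∀ v ∈ S, ⁅e, v⁆ ∈ S) (hh : ∀ v ∈ S, ⁅h, v⁆ ∈ S)
    (hp : ∀ v ∈ S, ⁅p, v⁆ ∈ S) (hq : ∀ v ∈ S, ⁅q, v⁆ ∈ S) (hz : ∀ v ∈ S, ⁅z, v⁆ ∈ S) :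
    S = ⊥ ∨ S = ⊤ := by
  have hS : (lieSubmoduleOfStable S he hh hp hq hz).toSubmodule = S := rfl
  rcases IsSimpleOrder.eq_bot_or_eq_top (lieSubmoduleOfStable S he hh hp hq hz) with h | h
  · left
    rw [← hS, h, LieSubmodule.bot_toSubmodule]
  · right
    rw [← hS, h, LieSubmodule.top_toSubmodule]

/-- A nonzero linear map between simple modules that commutes with the five basis elements is an
isomorphism. -/
theorem nonempty_equiv_of_commutes [LieModule.IsIrreducible ℂ Ageing V]
    [LieModule.IsIrreducible ℂ Ageing V'] (f : V' →ₗ[ℂ] V) (hf : f ≠ 0)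
    (he : ∀ v, f ⁅e, v⁆ = ⁅e, f v⁆) (hh : ∀ v, f ⁅h, v⁆ = ⁅h, f v⁆)
    (hp : ∀ v, f ⁅p, v⁆ = ⁅p, f v⁆) (hq : ∀ v, f ⁅q, v⁆ = ⁅q, f v⁆)
    (hz : ∀ v, f ⁅z, v⁆ = ⁅z, f v⁆) : Nonempty (V ≃ₗ⁅ℂ,Ageing⁆ V') := by
  have hker : LinearMap.ker f = ⊥ := by
    refine (eq_bot_or_eq_top_of_stable _ ?_ ?_ ?_ ?_ ?_).resolve_right
      fun h => hf (LinearMap.ker_eq_top.1 h)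
    all_goals
      intro v hv
      rw [LinearMap.mem_ker] at hv ⊢
      simp [he, hh, hp, hq, hz, hv]
  have hrange : LinearMap.range f = ⊤ := by
    refine (eq_bot_or_eq_top_of_stable _ ?_ ?_ ?_ ?_ ?_).resolve_left
      fun h => hf (LinearMap.range_eq_bot.1 h)
    · rintro _ ⟨v, rfl⟩; exact ⟨_, he v⟩
    · rintro _ ⟨v, rfl⟩; exact ⟨_, hh v⟩
    · rintro _ ⟨v, rfl⟩; exact ⟨_, hp v⟩
    · rintro _ ⟨v, rfl⟩; exact ⟨_, hq v⟩
    · rintro _ ⟨v, rfl⟩; exact ⟨_, hz v⟩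
  let f' : V' →ₗ⁅ℂ,Ageing⁆ V :=
    { f with
      map_lie' := by
        intro a v
        change f ⁅a, v⁆ = ⁅a, f v⁆
        rw [lie_eq_sum a v, lie_eq_sum a (f v)]
        simp only [map_add, map_smul, he, hh, hp, hq, hz] }
  have hf' : Function.Bijective f' := ⟨LinearMap.ker_eq_bot.1 hker, LinearMap.range_eq_top.1 hrange⟩
  let g : V' ≃ₗ⁅ℂ,Ageing⁆ V :=
    { f' with
      invFun := (LinearEquiv.ofBijective f hf').symm
      left_inv := (LinearEquiv.ofBijective f hf').left_inv
      right_inv := (LinearEquiv.ofBijective f hf').right_inv }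
  exact ⟨g.symm⟩

/-- A module graded by subspaces on which `h` and `z` act by scalars is a weight module. -/
theorem isWeightModule_of_graded {A : ℤ → Submodule ℂ V} {hdot zdot : ℂ}
    (hh : ∀ i, ∀ v ∈ A i, ⁅h, v⁆ = (hdot - i) • v) (hz : ∀ i, ∀ v ∈ A i, ⁅z, v⁆ = zdot • v)
    (htop : ⨆ i, A i = ⊤) : IsWeightModule V := by
  intro a ha
  obtain ⟨α, β, rfl⟩ := Submodule.mem_span_pair.1 ha
  refine top_le_iff.1 (htop ▸ iSup_le fun i => le_iSup_of_le (α * (hdot - i) + β * zdot) ?_)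
  intro v hv
  rw [Module.End.mem_eigenspace_iff, LieModule.toEnd_apply_apply, add_lie, smul_lie, smul_lie,
    hh i v hv, hz i v hv]
  module

/-- A module graded by weight spaces is simple if every nonzero homogeneous element generates it. -/
theorem isIrreducible_of_graded [Nontrivial V] {A : ℤ → Submodule ℂ V} {hdot : ℂ}
    (hh : ∀ i, ∀ v ∈ A i, ⁅h, v⁆ = (hdot - i) • v) (htop : ⨆ i, A i = ⊤)
    (H : ∀ (W : LieSubmodule ℂ Ageing V) (i : ℤ) (y : V), y ∈ W → y ≠ 0 → y ∈ A i →
      ∀ j, A j ≤ W.toSubmodule) : LieModule.IsIrreducible ℂ Ageing V := by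
  refine LieModule.IsIrreducible.mk fun W hW => ?_
  obtain ⟨i, y, hy, hy0, hyA⟩ := exists_homogeneous_mem (LieModule.toEnd ℂ Ageing V h)
    (c := fun i : ℤ => hdot - i) (fun i j hij => by simpa using hij) (A := A)
    (fun i v hv => Module.End.mem_eigenspace_iff.2 (hh i v hv)) htop W.toSubmodule
    (fun x hx => W.lie_mem hx) (by simpa using hW)
  rw [← LieSubmodule.toSubmodule_eq_top, ← top_le_iff, ← htop]
  exact iSup_le (H W i y hy hy0 hyA)

end Generators

/-! ### Values of `rep` on the five basis elements. -/

section RepApply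

variable {M : Type*} [AddCommGroup M] [Module ℂ M] (E H P Q Z : Module.End ℂ M)
    (hHE : H * E - E * H = (2 : ℂ) • E) (hHP : H * P - P * H = P) (hHQ : H * Q - Q * H = -Q)
    (hEQ : E * Q - Q * E = P) (hEP : E * P - P * E = 0) (hPQ : P * Q - Q * P = Z)
    (hZE : Z * E = E * Z) (hZH : Z * H = H * Z) (hZP : Z * P = P * Z) (hZQ : Z * Q = Q * Z)

theorem rep_e : rep E H P Q Z hHE hHP hHQ hEQ hEP hPQ hZE hZH hZP hZQ e = E := by
  change e.ce • E + e.ch • H + e.cp • P + e.cq • Q + e.cz • Z = E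
  simp [e]

theorem rep_h : rep E H P Q Z hHE hHP hHQ hEQ hEP hPQ hZE hZH hZP hZQ h = H := by
  change h.ce • E + h.ch • H + h.cp • P + h.cq • Q + h.cz • Z = H
  simp [h]

theorem rep_p : rep E H P Q Z hHE hHP hHQ hEQ hEP hPQ hZE hZH hZP hZQ p = P := by
  change p.ce • E + p.ch • H + p.cp • P + p.cq • Q + p.cz • Z = P
  simp [p]

theorem rep_q : rep E H P Q Z hHE hHP hHQ hEQ hEP hPQ hZE hZH hZP hZQ q = Q := by
  change q.ce • E + q.ch • H + q.cp • P + q.cq • Q + q.cz • Z = Q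
  simp [q]

theorem rep_z : rep E H P Q Z hHE hHP hHQ hEQ hEP hPQ hZE hZH hZP hZQ z = Z := by
  change z.ce • E + z.ch • H + z.cp • P + z.cq • Q + z.cz • Z = Z
  simp [z]

end RepApply

theorem iSup_span_T : ⨆ i : ℤ, ℂ ∙ (LaurentPolynomial.T i : ℂ[T;T⁻¹]) = ⊤ := by
  rw [← Submodule.span_range_eq_iSup]
  exact (AddMonoidAlgebra.basis ℤ ℂ).span_eq

/-! ### The modules `Q(λ, ḣ)` -/

namespace Q

variable (lam hdot : ℂ)

/-- The basis vector `x ^ i`. -/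
def x (i : ℤ) : Q lam hdot := (LaurentPolynomial.T i : ℂ[T;T⁻¹])

theorem lie_def (a : Ageing) (i : ℤ) :
    ⁅a, x lam hdot i⁆ = repr lam hdot a (LaurentPolynomial.T i) := rfl

theorem lie_e_x (i : ℤ) : ⁅e, x lam hdot i⁆ = lam • x lam hdot (i - 2) := by
  rw [lie_def, repr, rep_e]
  exact laurentOp_T _ _ i

theorem lie_h_x (i : ℤ) : ⁅h, x lam hdot i⁆ = (hdot - i) • x lam hdot i := by
  rw [lie_def, repr, rep_h]
  exact (laurentOp_T _ _ i).trans (by rw [add_zero]; rfl)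

theorem lie_p_x (i : ℤ) : ⁅p, x lam hdot i⁆ = 0 := by
  rw [lie_def, repr, rep_p]
  rfl

theorem lie_q_x (i : ℤ) : ⁅q, x lam hdot i⁆ = x lam hdot (i + 1) := by
  rw [lie_def, repr, rep_q]
  exact (laurentOp_T _ _ i).trans (one_smul _ _)

theorem lie_z_x (i : ℤ) : ⁅z, x lam hdot i⁆ = 0 := by
  rw [lie_def, repr, rep_z]
  rfl

theorem x_ne_zero (i : ℤ) : x lam hdot i ≠ 0 := (AddMonoidAlgebra.basis ℤ ℂ).ne_zero i

theorem iSup_span_x : ⨆ i : ℤ, ℂ ∙ x lam hdot i = ⊤ := iSup_span_T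

end Q

/-! ### The modules `Q'(ż, ḣ, λ)` -/

namespace Q'

variable (zdot hdot lam : ℂ)

/-- The basis vector `x ^ i`. -/
def x (i : ℤ) : Q' zdot hdot lam := (LaurentPolynomial.T i : ℂ[T;T⁻¹])

theorem lie_def (a : Ageing) (i : ℤ) :
    ⁅a, x zdot hdot lam i⁆ = repr zdot hdot lam a (LaurentPolynomial.T i) := rfl

theorem lie_e_x (i : ℤ) : ⁅e, x zdot hdot lam i⁆ =
    (zdot / 2 * (lam + i) * (lam + i - 1)) • x zdot hdot lam (i - 2) := by
  rw [lie_def, repr, rep_e]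
  exact laurentOp_T _ _ i

theorem lie_h_x (i : ℤ) : ⁅h, x zdot hdot lam i⁆ = (hdot - i) • x zdot hdot lam i := by
  rw [lie_def, repr, rep_h]
  exact (laurentOp_T _ _ i).trans (by rw [add_zero]; rfl)

theorem lie_p_x (i : ℤ) :
    ⁅p, x zdot hdot lam i⁆ = (zdot * (lam + i)) • x zdot hdot lam (i - 1) := by
  rw [lie_def, repr, rep_p]
  exact laurentOp_T _ _ i

theorem lie_q_x (i : ℤ) : ⁅q, x zdot hdot lam i⁆ = x zdot hdot lam (i + 1) := by
  rw [lie_def, repr, rep_q]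
  exact (laurentOp_T _ _ i).trans (one_smul _ _)

theorem lie_z_x (i : ℤ) : ⁅z, x zdot hdot lam i⁆ = zdot • x zdot hdot lam i := by
  rw [lie_def, repr, rep_z]
  exact (laurentOp_T _ _ i).trans (by rw [add_zero]; rfl)

theorem x_ne_zero (i : ℤ) : x zdot hdot lam i ≠ 0 := (AddMonoidAlgebra.basis ℤ ℂ).ne_zero i

theorem iSup_span_x : ⨆ i : ℤ, ℂ ∙ x zdot hdot lam i = ⊤ := iSup_span_T

end Q'

/-! ### Simplicity and weight property of Q and Q'. -/

section LaurentSimple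

variable {V : Type*} [AddCommGroup V] [Module ℂ V] [LieRingModule Ageing V] [LieModule ℂ Ageing V]

/-- A weight module with a basis of weight vectors `x i`, shifted up by `q` and mapped down by a
nonzero multiple by some element of the algebra, is simple. -/
theorem isIrreducible_of_shift {x : ℤ → V} (hx0 : ∀ i, x i ≠ 0) (hspan : ⨆ i : ℤ, ℂ ∙ x i = ⊤)
    {hdot : ℂ} (hh : ∀ i : ℤ, ⁅h, x i⁆ = (hdot - i) • x i) (hq : ∀ i, ⁅q, x i⁆ = x (i + 1))
    (a : Ageing) (d : ℤ) (hd : 0 < d) (c : ℤ → ℂ) (hc : ∀ i, c i ≠ 0)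
    (ha : ∀ i, ⁅a, x i⁆ = c i • x (i - d)) : LieModule.IsIrreducible ℂ Ageing V := by
  have : Nontrivial V := ⟨⟨x 0, 0, hx0 0⟩⟩
  refine isIrreducible_of_graded (A := fun i => ℂ ∙ x i) (hdot := hdot) ?_ hspan ?_
  · intro i v hv
    obtain ⟨b, rfl⟩ := Submodule.mem_span_singleton.1 hv
    rw [lie_smul, hh, smul_comm]
  · intro W i y hy hy0 hyi
    obtain ⟨b, rfl⟩ := Submodule.mem_span_singleton.1 hyi
    have hb : b ≠ 0 := fun h => hy0 (by rw [h, zero_smul])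
    have hxi : x i ∈ W.toSubmodule := (Submodule.smul_mem_iff _ hb).1 hy
    have up (n : ℕ) : ∀ j, x j ∈ W.toSubmodule → x (j + n) ∈ W.toSubmodule := by
      induction n with
      | zero => intro j hj; simpa using hj
      | succ n ih =>
        intro j hj
        have := W.lie_mem (x := q) (ih j hj)
        rw [hq] at this
        rwa [Nat.cast_succ, ← add_assoc]
    have down (n : ℕ) : x (i - n * d) ∈ W.toSubmodule := by
      induction n with
      | zero => simpa using hxi
      | succ n ih =>
        have := W.lie_mem (x := a) ih
        rw [ha] at this
        have := (Submodule.smul_mem_iff W.toSubmodule (hc _)).1 this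
        rwa [Nat.cast_succ, add_mul, one_mul, ← sub_sub]
    intro j
    rw [Submodule.span_singleton_le_iff_mem]
    -- The lowering step d may exceed 1, so x j is reached by descending to or below j and then
    -- climbing with q.
    have hle : i - (i - j).toNat * d ≤ j := by
      have h1 : i - j ≤ (i - j).toNat := Int.self_le_toNat _
      nlinarith [Int.natCast_nonneg (i - j).toNat]
    obtain ⟨m, hm⟩ := Int.le.dest hle
    rw [← hm]
    exact up m _ (down _)

end LaurentSimple

theorem Q.isIrreducible (lam hdot : ℂ) (hlam : lam ≠ 0) :
    LieModule.IsIrreducible ℂ Ageing (Q lam hdot) :=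
  isIrreducible_of_shift (Q.x_ne_zero lam hdot) (Q.iSup_span_x lam hdot) (Q.lie_h_x lam hdot)
    (Q.lie_q_x lam hdot) e 2 two_pos (fun _ => lam) (fun _ => hlam) (Q.lie_e_x lam hdot)

theorem Q.isWeightModule (lam hdot : ℂ) : IsWeightModule (Q lam hdot) := by
  refine isWeightModule_of_graded (A := fun i => ℂ ∙ Q.x lam hdot i) (hdot := hdot) (zdot := 0)
    ?_ ?_ (Q.iSup_span_x lam hdot)
  all_goals
    intro i v hv
    obtain ⟨b, rfl⟩ := Submodule.mem_span_singleton.1 hv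
  · rw [lie_smul, Q.lie_h_x, smul_comm]
  · rw [lie_smul, Q.lie_z_x, smul_zero, zero_smul]

theorem Q'.isIrreducible (zdot hdot lam : ℂ) (hz : zdot ≠ 0) (hlam : ∀ n : ℤ, lam ≠ n) :
    LieModule.IsIrreducible ℂ Ageing (Q' zdot hdot lam) :=
  isIrreducible_of_shift (Q'.x_ne_zero zdot hdot lam) (Q'.iSup_span_x zdot hdot lam)
    (Q'.lie_h_x zdot hdot lam) (Q'.lie_q_x zdot hdot lam) p 1 one_pos
    (fun i => zdot * (lam + i)) (fun i => mul_ne_zero hz fun h0 => hlam (-i) (by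
      push_cast; exact eq_neg_of_add_eq_zero_left h0)) (Q'.lie_p_x zdot hdot lam)

theorem Q'.isWeightModule (zdot hdot lam : ℂ) : IsWeightModule (Q' zdot hdot lam) := by
  refine isWeightModule_of_graded (A := fun i => ℂ ∙ Q'.x zdot hdot lam i) (hdot := hdot)
    (zdot := zdot) ?_ ?_ (Q'.iSup_span_x zdot hdot lam)
  all_goals
    intro i v hv
    obtain ⟨b, rfl⟩ := Submodule.mem_span_singleton.1 hv
  · rw [lie_smul, Q'.lie_h_x, smul_comm]
  · rw [lie_smul, Q'.lie_z_x, smul_comm]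

/-! ### The modules `N_{ż, ḣ}` -/

namespace NMod

variable (zdot hdot : ℂ) (N : Type*) [AddCommGroup N] [Module ℂ N]

/-- The linear map `v ↦ v ⊗ x ^ i`. -/
def ι (i : ℤ) : N →ₗ[ℂ] NMod zdot hdot N :=
  (TensorProduct.mk ℂ N ℂ[T;T⁻¹]).flip (LaurentPolynomial.T i)

theorem ι_injective (i : ℤ) : Function.Injective (ι zdot hdot N i) := by
  let g : N ⊗[ℂ] ℂ[T;T⁻¹] →ₗ[ℂ] N := TensorProduct.rid ℂ N ∘ₗ
    LinearMap.lTensor N ((AddMonoidAlgebra.basis ℤ ℂ).coord i)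
  refine Function.LeftInverse.injective (g := g) fun v => ?_
  change TensorProduct.rid ℂ N (LinearMap.lTensor N ((AddMonoidAlgebra.basis ℤ ℂ).coord i)
    (v ⊗ₜ AddMonoidAlgebra.basis ℤ ℂ i)) = v
  rw [LinearMap.lTensor_tmul, TensorProduct.rid_tmul, Module.Basis.coord_apply,
    Module.Basis.repr_self, Finsupp.single_eq_same, one_smul]

theorem iSup_range_ι : ⨆ i : ℤ, LinearMap.range (ι zdot hdot N i) = ⊤ := by
  refine top_le_iff.1 fun w _ => ?_
  have hw : w ∈ (⊤ : Submodule ℂ (N ⊗[ℂ] ℂ[T;T⁻¹])) := trivial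
  rw [← TensorProduct.span_tmul_eq_top] at hw
  refine Submodule.span_le.2 ?_ hw
  rintro _ ⟨v, f, rfl⟩
  have hf : f ∈ ⨆ i : ℤ, ℂ ∙ (LaurentPolynomial.T i : ℂ[T;T⁻¹]) := iSup_span_T ▸ trivial
  have hle : (⨆ i : ℤ, ℂ ∙ (LaurentPolynomial.T i : ℂ[T;T⁻¹])) ≤
      (⨆ i : ℤ, LinearMap.range (ι zdot hdot N i)).comap (TensorProduct.mk ℂ N ℂ[T;T⁻¹] v) :=
    iSup_le fun i => (Submodule.span_singleton_le_iff_mem _ _).2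
      (Submodule.mem_iSup_of_mem i ⟨v, rfl⟩)
  exact hle hf

variable {N} in
theorem hom_ext {M : Type*} [AddCommGroup M] [Module ℂ M] {f g : NMod zdot hdot N →ₗ[ℂ] M}
    (H : ∀ i v, f (ι zdot hdot N i v) = g (ι zdot hdot N i v)) : f = g :=
  TensorProduct.ext (LinearMap.ext fun v => laurent_ext fun i => H i v)

variable [Module (R zdot) N] [IsScalarTower ℂ (R zdot) N]

theorem lie_def (a : Ageing) (i : ℤ) (v : N) :
    ⁅a, ι zdot hdot N i v⁆ = repr zdot hdot N a (v ⊗ₜ LaurentPolynomial.T i) := rfl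

theorem lie_e_ι (i : ℤ) (v : N) :
    ⁅e, ι zdot hdot N i v⁆ = ι zdot hdot N (i - 2) (coeffE zdot N i v) := by
  rw [lie_def, repr, rep_e]
  exact tensorOp_tmul_T _ _ i v

theorem lie_h_ι (i : ℤ) (v : N) : ⁅h, ι zdot hdot N i v⁆ = (hdot - i) • ι zdot hdot N i v := by
  rw [lie_def, repr, rep_h]
  exact (tensorOp_tmul_T _ _ i v).trans (by rw [add_zero]; rfl)

theorem lie_p_ι (i : ℤ) (v : N) :
    ⁅p, ι zdot hdot N i v⁆ = ι zdot hdot N (i - 1) (coeffP zdot N i v) := by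
  rw [lie_def, repr, rep_p]
  exact tensorOp_tmul_T _ _ i v

theorem lie_q_ι (i : ℤ) (v : N) : ⁅q, ι zdot hdot N i v⁆ = ι zdot hdot N (i + 1) v := by
  rw [lie_def, repr, rep_q]
  exact tensorOp_tmul_T _ _ i v

theorem lie_z_ι (i : ℤ) (v : N) : ⁅z, ι zdot hdot N i v⁆ = zdot • ι zdot hdot N i v := by
  rw [lie_def, repr, rep_z]
  exact (tensorOp_tmul_T _ _ i v).trans (by rw [add_zero]; rfl)

theorem isWeightModule : IsWeightModule (NMod zdot hdot N) := by
  refine isWeightModule_of_graded (A := fun i => LinearMap.range (ι zdot hdot N i)) (hdot := hdot)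
    (zdot := zdot) ?_ ?_ (iSup_range_ι zdot hdot N)
  · rintro i _ ⟨v, rfl⟩
    exact lie_h_ι zdot hdot N i v
  · rintro i _ ⟨v, rfl⟩
    exact lie_z_ι zdot hdot N i v

theorem isIrreducible [IsSimpleModule (R zdot) N] (hN : ¬ FiniteDimensional ℂ N) :
    LieModule.IsIrreducible ℂ Ageing (NMod zdot hdot N) := by
  have hnt : Nontrivial N := IsSimpleModule.nontrivial (R zdot) N
  have hsimple := isSimplePair_of_isSimpleModule zdot N
  have : Nontrivial (NMod zdot hdot N) := (ι_injective zdot hdot N 0).nontrivial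
  refine isIrreducible_of_graded (A := fun i => LinearMap.range (ι zdot hdot N i)) (hdot := hdot)
    (by rintro i _ ⟨v, rfl⟩; exact lie_h_ι zdot hdot N i v) (iSup_range_ι zdot hdot N) ?_
  intro W i y hy hy0 hyi
  obtain ⟨v, rfl⟩ := hyi
  -- S j is the degree-j slice of W. Raising by q and returning with p, or raising by q² and
  -- returning with e, shows that it is R_ż-stable, hence trivial.
  let S (j : ℤ) : Submodule ℂ N := W.toSubmodule.comap (ι zdot hdot N j)
  have hqS (j : ℤ) (w : N) (hw : w ∈ S j) : w ∈ S (j + 1) := by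
    have := W.lie_mem (x := q) (m := ι zdot hdot N j w) hw
    rwa [lie_q_ι] at this
  have hpS (j : ℤ) (w : N) (hw : w ∈ S j) : coeffP zdot N j w ∈ S (j - 1) := by
    have := W.lie_mem (x := p) (m := ι zdot hdot N j w) hw
    rwa [lie_p_ι] at this
  have heS (j : ℤ) (w : N) (hw : w ∈ S j) : coeffE zdot N j w ∈ S (j - 2) := by
    have := W.lie_mem (x := e) (m := ι zdot hdot N j w) hw
    rwa [lie_e_ι] at this
  have htriv (j : ℤ) : S j = ⊥ ∨ S j = ⊤ := by
    have hP : ∀ w ∈ S j, act zdot N (phiPQ zdot) w ∈ S j := by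
      intro w hw
      have := hpS (j + 1) w (hqS j w hw)
      rw [add_sub_cancel_right, coeffP, LinearMap.add_apply] at this
      exact ((S j).add_mem_iff_left (by simpa using (S j).smul_mem _ hw)).1 this
    have hE : ∀ w ∈ S j, act zdot N (phiEQQ zdot) w ∈ S j := by
      intro w hw
      have := heS (j + 1 + 1) w (hqS _ w (hqS j w hw))
      rw [show j + 1 + 1 - 2 = j by ring, coeffE, LinearMap.add_apply, LinearMap.add_apply,
        add_assoc] at this
      exact ((S j).add_mem_iff_left (add_mem ((S j).smul_mem _ (hP w hw))
        ((S j).smul_mem _ hw))).1 this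
    obtain ⟨h1, h2⟩ := (phiPQ_mem_iff zdot (act zdot N) (S j)).1 ⟨hP, hE⟩
    exact hsimple (S j) h1 h2
  have hup (j : ℤ) (hj : S j = ⊤) : S (j + 1) = ⊤ :=
    top_le_iff.1 fun w _ => hqS j w (hj ▸ trivial)
  have hdown (j : ℤ) (hj : S j = ⊤) : S (j - 1) = ⊤ := by
    -- If the slice dropped from N to zero, p would vanish on N ⊗ x^j, and pq would act on N by the
    -- scalar -(j - 1)ż.
    refine (htriv (j - 1)).resolve_left fun h0 => hN ?_
    refine finiteDimensional_of_phiPQ_eq_smul zdot N (-((j : ℂ) - 1)) ?_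
    have hP : coeffP zdot N j = 0 := LinearMap.ext fun w => by
      have := hpS j w (hj ▸ trivial)
      rwa [h0, Submodule.mem_bot] at this
    rw [coeffP] at hP
    rw [eq_neg_of_add_eq_zero_left hP, neg_mul, neg_smul]
  have hi : S i = ⊤ := (htriv i).resolve_left fun h0 => by
    have : v ∈ S i := hy
    rw [h0, Submodule.mem_bot] at this
    exact hy0 (by rw [this, map_zero])
  intro j
  have hj : S j = ⊤ := by
    refine Int.inductionOn' (motive := fun j => S j = ⊤) j i hi (fun k _ ih => hup k ih)
      fun k _ ih => hdown k ih
  rintro _ ⟨w, rfl⟩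
  have : w ∈ S j := hj ▸ trivial
  exact this

end NMod

/-! ### Commuting `pq` and `eq²` past powers of `q` -/

section Shift

variable {A : Type*} [Ring A] [Algebra ℂ A]

/-- `B` behaves like `q ^ j` under commutation with `X = pq` and `Y = eq²`. -/
def IsShift (X Y : A) (c : ℂ) (B : A) (j : ℂ) : Prop :=
  X * B = B * X + (j * c) • B ∧ Y * B = B * Y + j • (B * X) + (j * (j + 1) / 2 * c) • B

variable {X Y B C : A} {c j k : ℂ}

theorem IsShift.one : IsShift X Y c 1 0 := by constructor <;> simp

/-- Exponents add because j(j+1)/2 + k(k+1)/2 + jk = (j+k)(j+k+1)/2; the cross term jk arises from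
moving X past C. -/
theorem IsShift.mul (hB : IsShift X Y c B j) (hC : IsShift X Y c C k) :
    IsShift X Y c (B * C) (j + k) := by
  constructor
  · rw [← mul_assoc, hB.1, add_mul, mul_assoc B X C, hC.1, smul_mul_assoc, mul_add,
      mul_smul_comm, ← mul_assoc]
    module
  · rw [← mul_assoc, hB.2, add_mul, add_mul, mul_assoc B Y C, hC.2, smul_mul_assoc,
      smul_mul_assoc, mul_assoc B X C, hC.1]
    simp only [mul_add, mul_smul_comm, ← mul_assoc]
    module

theorem IsShift.pow (hB : IsShift X Y c B 1) (n : ℕ) : IsShift X Y c (B ^ n) n := by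
  induction n with
  | zero => simpa using IsShift.one
  | succ n ih => simpa [pow_succ] using ih.mul hB

/-- Multiply the two relations for w by w⁻¹ on both sides. This extends the commutation rules to all
integer powers of an invertible q. -/
theorem IsShift.inv {w : Aˣ} (hw : IsShift X Y c (w : A) 1) :
    IsShift X Y c ((w⁻¹ : Aˣ) : A) (-1) := by
  have h1 : X * ((w⁻¹ : Aˣ) : A) = ((w⁻¹ : Aˣ) : A) * X + (-1 * c) • ((w⁻¹ : Aˣ) : A) := by
    have := congrArg (fun a => ((w⁻¹ : Aˣ) : A) * a * ((w⁻¹ : Aˣ) : A)) hw.1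
    simp only [mul_add, add_mul, mul_assoc, Units.mul_inv, mul_one, Units.inv_mul_cancel_left,
      mul_smul_comm, smul_mul_assoc] at this
    rw [this]
    module
  refine ⟨h1, ?_⟩
  have := congrArg (fun a => ((w⁻¹ : Aˣ) : A) * a * ((w⁻¹ : Aˣ) : A)) hw.2
  simp only [mul_add, add_mul, mul_assoc, Units.mul_inv, mul_one, Units.inv_mul_cancel_left,
    mul_smul_comm, smul_mul_assoc, h1] at this
  rw [this]
  module

theorem IsShift.zpow {w : Aˣ} (hw : IsShift X Y c (w : A) 1) (i : ℤ) :
    IsShift X Y c ((w ^ i : Aˣ) : A) i := by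
  induction i using Int.induction_on with
  | zero => simpa using IsShift.one
  | succ n ih =>
    rw [zpow_add_one, Units.val_mul]
    simpa using ih.mul hw
  | pred n ih =>
    rw [zpow_sub_one, Units.val_mul]
    simpa [sub_eq_add_neg] using ih.mul hw.inv

end Shift

theorem exists_algHom_phi (zdot : ℂ) {A : Type*} [Ring A] [Algebra ℂ A] (X Y : A)
    (h : Y * X = X * Y + ((-2 * zdot) • Y + zdot • X + X * X)) :
    ∃ f : R zdot →ₐ[ℂ] A, f (phiPQ zdot) = X ∧ f (phiEQQ zdot) = Y := by
  by_cases hz : zdot = 0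
  · obtain ⟨f, hX, hY⟩ := exists_algHom_R zdot X Y (by simpa [relExp, hz, pow_two] using h)
    exact ⟨f, by simp [phiPQ, hz, ← hX], by simp [phiEQQ, hz, ← hY]⟩
  · set θ : A := (2 * zdot)⁻¹ • X with hθ
    have h2 : (2 * zdot) ≠ 0 := mul_ne_zero two_ne_zero hz
    have hX : X = (2 * zdot) • θ := by rw [hθ, smul_inv_smul₀ h2]
    -- The formulas for `phiPQ` and `phiEQQ` are solved for θ and t. As t differs from Y by a
    -- polynomial in θ, the relation θt = tθ + t is the given one divided by 2ż.
    obtain ⟨f, hf, hfθ⟩ := exists_algHom_R zdot (Y - zdot • θ - (2 * zdot) • θ ^ 2) θ (by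
      have h' : (2 * zdot) • (Y * θ) =
          (2 * zdot) • (θ * Y - Y + zdot • θ + (2 * zdot) • (θ * θ)) := by
        rw [← mul_smul_comm, ← hX, h, hX]
        simp only [smul_mul_assoc, mul_smul_comm]
        module
      have h3 := (smul_right_injective A h2) h'
      simp only [relExp, hz, if_false, zero_add, pow_one, mul_sub, sub_mul, mul_smul_comm,
        smul_mul_assoc, pow_two, mul_assoc]
      rw [h3]
      module)
    refine ⟨f, by simp [phiPQ, hz, hfθ, hX], ?_⟩
    simp only [phiEQQ, hz, if_false, map_add, map_smul, map_pow, hf, hfθ]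
    module

/-! ### Simple modules on which `q` is injective -/

section Operators

variable {V : Type*} [AddCommGroup V] [Module ℂ V]

/-- The operators of `e`, `h`, `p`, `q` on a simple module with central charge `c`. -/
structure IsSimpleAction (E H P Q : Module.End ℂ V) (c : ℂ) : Prop where
  he : H * E = E * H + (2 : ℂ) • E
  hp : H * P = P * H + P
  hq : H * Q = Q * H - Q
  eq : E * Q = Q * E + P
  ep : E * P = P * E
  pq : P * Q = Q * P + c • 1
  simple : ∀ S : Submodule ℂ V, (∀ v ∈ S, E v ∈ S) → (∀ v ∈ S, H v ∈ S) → (∀ v ∈ S, P v ∈ S) →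
    (∀ v ∈ S, Q v ∈ S) → S = ⊥ ∨ S = ⊤

namespace IsSimpleAction

variable {E H P Q : Module.End ℂ V} {c : ℂ} (hV : IsSimpleAction E H P Q c)
include hV

theorem isShift : IsShift (P * Q) (E * Q * Q) c Q 1 := by
  have h1 : P * Q * Q = Q * (P * Q) + (1 * c) • Q := by
    nth_rw 1 [hV.pq]
    simp [add_mul, mul_assoc]
  refine ⟨h1, ?_⟩
  nth_rw 1 [hV.eq]
  rw [add_mul, add_mul, h1]
  simp only [mul_assoc]
  module

/-- Moving every q to the right turns YX into epq³ - 2c eq² and XY into epq³ - p²q², since e and p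
commute; and p²q² = X² + cX. -/
theorem relation : (E * Q * Q) * (P * Q) = (P * Q) * (E * Q * Q) +
    ((-2 * c) • (E * Q * Q) + c • (P * Q) + (P * Q) * (P * Q)) := by
  have h1 : Q * P = P * Q - c • 1 := by rw [hV.pq]; abel
  have h2 : Q * E = E * Q - P := by rw [hV.eq]; abel
  have e1 : (E * Q * Q) * (P * Q) = E * P * Q * Q * Q - (2 * c) • (E * Q * Q) := by
    have : (E * Q * Q) * (P * Q) = E * Q * (Q * P) * Q := by noncomm_ring
    rw [this, h1]
    have : E * Q * (P * Q - c • 1) * Q = E * (Q * P) * Q * Q - c • (E * Q * Q) := by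
      simp only [mul_sub, sub_mul, mul_smul_comm, smul_mul_assoc, mul_one, mul_assoc]
    rw [this, h1]
    simp only [mul_sub, sub_mul, mul_smul_comm, smul_mul_assoc, mul_one, mul_assoc]
    module
  have e2 : (P * Q) * (E * Q * Q) = E * P * Q * Q * Q - P * P * Q * Q := by
    have : (P * Q) * (E * Q * Q) = P * (Q * E) * Q * Q := by noncomm_ring
    rw [this, h2, hV.ep]
    noncomm_ring
  have e3 : (P * Q) * (P * Q) = P * P * Q * Q - c • (P * Q) := by
    have : (P * Q) * (P * Q) = P * (Q * P) * Q := by noncomm_ring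
    rw [this, h1]
    simp only [mul_sub, sub_mul, mul_smul_comm, smul_mul_assoc, mul_one, mul_assoc]
  rw [e1, e2, e3]
  module

theorem p_mul_pow (m : ℕ) : P * Q ^ (m + 1) = Q ^ (m + 1) * P + ((m + 1 : ℂ) * c) • Q ^ m := by
  induction m with
  | zero => simpa using hV.pq
  | succ m ih =>
    rw [pow_succ Q (m + 1), ← mul_assoc, ih, add_mul, mul_assoc _ P Q, hV.pq, mul_add,
      mul_smul_comm, mul_one, smul_mul_assoc, ← pow_succ, ← mul_assoc]
    push_cast
    module

theorem e_mul_pow (m : ℕ) : E * Q ^ (m + 2) = Q ^ (m + 2) * E + (m + 2 : ℂ) • (Q ^ (m + 1) * P) +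
    ((m + 2 : ℂ) * (m + 1) / 2 * c) • Q ^ m := by
  induction m with
  | zero =>
    rw [zero_add, zero_add, pow_two, ← mul_assoc, hV.eq, add_mul, mul_assoc, hV.eq, hV.pq]
    simp only [mul_add, pow_zero, pow_one, ← mul_assoc]
    push_cast
    module
  | succ m ih =>
    rw [show m + 1 + 2 = m + 2 + 1 from rfl, pow_succ Q (m + 2), ← mul_assoc, ih, add_mul, add_mul,
      mul_assoc _ E Q, hV.eq, smul_mul_assoc, smul_mul_assoc, mul_assoc _ P Q, hV.pq]
    simp only [mul_add, mul_smul_comm, mul_one, ← mul_assoc, ← pow_succ]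
    push_cast
    module

theorem mem_eigenspace_q {μ : ℂ} {v : V} (hv : H v = μ • v) : H (Q v) = (μ - 1) • Q v := by
  have := congrArg (fun f : Module.End ℂ V => f v) hV.hq
  simp only [Module.End.mul_apply, LinearMap.sub_apply, hv, map_smul] at this
  rw [this]
  module

theorem mem_eigenspace_p {μ : ℂ} {v : V} (hv : H v = μ • v) : H (P v) = (μ + 1) • P v := by
  have := congrArg (fun f : Module.End ℂ V => f v) hV.hp
  simp only [Module.End.mul_apply, LinearMap.add_apply, hv, map_smul] at this
  rw [this]
  module

theorem mem_eigenspace_e {μ : ℂ} {v : V} (hv : H v = μ • v) : H (E v) = (μ + 2) • E v := by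
  have := congrArg (fun f : Module.End ℂ V => f v) hV.he
  simp only [Module.End.mul_apply, LinearMap.add_apply, LinearMap.smul_apply, hv, map_smul] at this
  rw [this]
  module

theorem mem_eigenspace_pq {μ : ℂ} {v : V} (hv : H v = μ • v) : H (P (Q v)) = μ • P (Q v) := by
  simpa using hV.mem_eigenspace_p (hV.mem_eigenspace_q hv)

theorem mem_eigenspace_eqq {μ : ℂ} {v : V} (hv : H v = μ • v) :
    H (E (Q (Q v))) = μ • E (Q (Q v)) := by
  have := hV.mem_eigenspace_e (hV.mem_eigenspace_q (hV.mem_eigenspace_q hv))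
  rw [this]
  congr 1
  ring

/-- The weight spaces are simple under `pq` and `eq²` if `q` is injective. -/
theorem eq_eigenspace (hinj : Function.Injective Q) (μ : ℂ) (N : Submodule ℂ V)
    (hN : N ≤ H.eigenspace μ) (hN0 : N ≠ ⊥) (hX : ∀ v ∈ N, P (Q v) ∈ N)
    (hY : ∀ v ∈ N, E (Q (Q v)) ∈ N) : N = H.eigenspace μ := by
  have hinj' (a : ℕ) : Function.Injective (Q ^ a) := by
    rw [Module.End.coe_pow]
    exact hinj.iterate a
  -- D b = q^b N is stable under pq and eq², by the shift relations for q^b.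
  let D (b : ℕ) : Submodule ℂ V := N.map (Q ^ b)
  have hDQ (m b : ℕ) {w : V} (hw : w ∈ D b) : (Q ^ m) w ∈ D (b + m) := by
    obtain ⟨n, hn, rfl⟩ := hw
    exact ⟨n, hn, by rw [add_comm, pow_add, Module.End.mul_apply]⟩
  have hDX (b : ℕ) {w : V} (hw : w ∈ D b) : P (Q w) ∈ D b := by
    obtain ⟨n, hn, rfl⟩ := hw
    have := congrArg (fun f : Module.End ℂ V => f n) (hV.isShift.pow b).1
    simp only [Module.End.mul_apply, LinearMap.add_apply, LinearMap.smul_apply] at this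
    rw [this]
    exact add_mem ⟨_, hX n hn, rfl⟩ ((D b).smul_mem _ ⟨n, hn, rfl⟩)
  have hDY (b : ℕ) {w : V} (hw : w ∈ D b) : E (Q (Q w)) ∈ D b := by
    obtain ⟨n, hn, rfl⟩ := hw
    have := congrArg (fun f : Module.End ℂ V => f n) (hV.isShift.pow b).2
    simp only [Module.End.mul_apply, LinearMap.add_apply, LinearMap.smul_apply] at this
    rw [this]
    exact add_mem (add_mem ⟨_, hY n hn, rfl⟩ ((D b).smul_mem _ ⟨_, hX n hn, rfl⟩))
      ((D b).smul_mem _ ⟨n, hn, rfl⟩)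
  -- Up to a multiple of q^a w, the vector q^(a+1) p w is pq applied to q^a w. The statement for e
  -- below has the same form.
  have hP (a b : ℕ) {w : V} (hw : (Q ^ a) w ∈ D b) : (Q ^ (a + 1)) (P w) ∈ D b := by
    have := congrArg (fun f : Module.End ℂ V => f w) (hV.p_mul_pow a)
    simp only [pow_succ' Q a, Module.End.mul_apply, LinearMap.add_apply, LinearMap.smul_apply]
      at this
    rw [pow_succ', Module.End.mul_apply, ← (D b).add_mem_iff_left ((D b).smul_mem _ hw), ← this]
    exact hDX b hw
  have hE (a b : ℕ) {w : V} (hw : (Q ^ a) w ∈ D b) : (Q ^ (a + 2)) (E w) ∈ D b := by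
    have := congrArg (fun f : Module.End ℂ V => f w) (hV.e_mul_pow a)
    simp only [Module.End.mul_apply, LinearMap.add_apply, LinearMap.smul_apply] at this
    rw [← (D b).add_mem_iff_left ((D b).smul_mem _ (hP a b hw)),
      ← (D b).add_mem_iff_left ((D b).smul_mem _ hw), ← this, pow_succ', pow_succ']
    exact hDY b hw
  -- W i plays the role of q^i N for any integer i, although q need not be invertible: its vectors
  -- are fractions q^(-a) q^b n with b - a = i. The sum of the W i is a submodule, and its part of
  -- weight μ is N because q is injective.
  let W (i : ℤ) : Submodule ℂ V :=
    { carrier := {w | H w = (μ - i) • w ∧ ∃ a b : ℕ, (b : ℤ) = a + i ∧ (Q ^ a) w ∈ D b}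
      zero_mem' := ⟨by simp, (-i).toNat, i.toNat, by omega, by simp⟩
      add_mem' := by
        rintro w w' ⟨hw, a, b, hab, hD⟩ ⟨hw', a', b', hab', hD'⟩
        refine ⟨by rw [map_add, hw, hw', smul_add], a + a', b + a', by push_cast; omega, ?_⟩
        rw [map_add]
        refine add_mem ?_ ?_
        · rw [add_comm a, pow_add, Module.End.mul_apply]
          exact hDQ a' b hD
        · rw [pow_add, Module.End.mul_apply, show b + a' = b' + a by omega]
          exact hDQ a b' hD'
      smul_mem' := by
        rintro r w ⟨hw, a, b, hab, hD⟩
        refine ⟨by rw [map_smul, hw, smul_comm], a, b, hab, ?_⟩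
        rw [map_smul]
        exact (D b).smul_mem r hD }
  have hW (f : Module.End ℂ V) (d : ℤ) (h : ∀ i, ∀ w ∈ W i, f w ∈ W (i + d)) :
      ∀ w ∈ ⨆ i, W i, f w ∈ ⨆ i, W i := by
    intro w hw
    have hle : ⨆ i, W i ≤ (⨆ i, W i).comap f :=
      iSup_le fun i w hw => Submodule.mem_iSup_of_mem _ (h i w hw)
    exact hle hw
  have hNW : N ≤ W 0 := fun n hn =>
    ⟨by simpa using Module.End.mem_eigenspace_iff.1 (hN hn), 0, 0, by simp, n, hn, rfl⟩
  have htop : ⨆ i, W i = ⊤ := by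
    refine (hV.simple _ (hW E (-2) ?_) (hW H 0 ?_) (hW P (-1) ?_) (hW Q 1 ?_)).resolve_left
      fun h => hN0 (le_bot_iff.1 (h ▸ hNW.trans (le_iSup W 0)))
    · rintro i w ⟨hw, a, b, hab, hD⟩
      refine ⟨?_, a + 2, b, by push_cast; omega, hE a b hD⟩
      rw [hV.mem_eigenspace_e hw]
      congr 1; push_cast; ring
    · rintro i w ⟨hw, a, b, hab, hD⟩
      rw [hw, add_zero]
      exact (W i).smul_mem _ ⟨hw, a, b, hab, hD⟩
    · rintro i w ⟨hw, a, b, hab, hD⟩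
      refine ⟨?_, a + 1, b, by push_cast; omega, hP a b hD⟩
      rw [hV.mem_eigenspace_p hw]
      congr 1; push_cast; ring
    · rintro i w ⟨hw, a, b, hab, hD⟩
      refine ⟨?_, a, b + 1, by push_cast; omega, ?_⟩
      · rw [hV.mem_eigenspace_q hw]
        congr 1; push_cast; ring
      · rw [← Module.End.mul_apply, ← pow_succ, pow_succ', Module.End.mul_apply]
        simpa using hDQ 1 b hD
  refine le_antisymm hN fun w hw => ?_
  obtain ⟨-, a, b, hab, n, hn, hnw⟩ : w ∈ W 0 :=
    mem_of_mem_iSup_of_eigenvector H (c := fun i : ℤ => μ - i) (fun i j hij => by simpa using hij)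
      (A := W) (fun i v hv => Module.End.mem_eigenspace_iff.2 hv.1) (htop ▸ trivial)
      (by simpa using Module.End.mem_eigenspace_iff.1 hw)
  obtain rfl : a = b := by omega
  rwa [← hinj' a hnw]

/-- `q` is surjective if it is injective and there are no highest weight vectors. -/
theorem surjective_q (hdiag : ⨆ μ : ℂ, H.eigenspace μ = ⊤) (hinj : Function.Injective Q)
    (hhw : ∀ (μ : ℂ) (v : V), H v = μ • v → E v = 0 → P v = 0 → v = 0) :
    Function.Surjective Q := by
  rw [← LinearMap.range_eq_top, ← top_le_iff, ← hdiag]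
  refine iSup_le fun ν => ?_
  let N := (H.eigenspace (ν + 1)).map Q
  have hNν : N ≤ H.eigenspace ν := by
    rintro _ ⟨w, hw, rfl⟩
    rw [Module.End.mem_eigenspace_iff]
    simpa using hV.mem_eigenspace_q (Module.End.mem_eigenspace_iff.1 hw)
  by_cases hN0 : N = ⊥
  -- Here V_(ν+1) = 0. For v of weight ν both pv and q(ev) lie in that weight space, so pv = 0 and,
  -- by injectivity, ev = 0.
  · have hzero {w : V} (hw : H w = (ν + 1) • w) : w = 0 := by
      have hQw : Q w ∈ N := ⟨w, Module.End.mem_eigenspace_iff.2 hw, rfl⟩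
      rw [hN0, Submodule.mem_bot] at hQw
      exact hinj (hQw.trans (map_zero Q).symm)
    intro v hv
    rw [Module.End.mem_eigenspace_iff] at hv
    have hQE : Q (E v) = 0 := hzero (by
      rw [hV.mem_eigenspace_q (hV.mem_eigenspace_e hv)]
      congr 1; ring)
    rw [hhw ν v hv (hinj (hQE.trans (map_zero Q).symm)) (hzero (hV.mem_eigenspace_p hv))]
    exact zero_mem _
  · rw [← hV.eq_eigenspace hinj ν N hNν hN0]
    · rintro _ ⟨w, -, rfl⟩
      exact ⟨w, rfl⟩
    · rintro _ ⟨w, hw, rfl⟩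
      have hw' := Module.End.mem_eigenspace_iff.1 hw
      have := congrArg (fun f : Module.End ℂ V => f w) hV.isShift.1
      simp only [Module.End.mul_apply, LinearMap.add_apply, LinearMap.smul_apply] at this
      rw [this]
      exact add_mem ⟨_, Module.End.mem_eigenspace_iff.2 (hV.mem_eigenspace_pq hw'), rfl⟩
        (N.smul_mem _ ⟨w, hw, rfl⟩)
    · rintro _ ⟨w, hw, rfl⟩
      have hw' := Module.End.mem_eigenspace_iff.1 hw
      have := congrArg (fun f : Module.End ℂ V => f w) hV.isShift.2
      simp only [Module.End.mul_apply, LinearMap.add_apply, LinearMap.smul_apply] at this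
      rw [this]
      exact add_mem (add_mem
        ⟨_, Module.End.mem_eigenspace_iff.2 (hV.mem_eigenspace_eqq hw'), rfl⟩
        (N.smul_mem _ ⟨_, Module.End.mem_eigenspace_iff.2 (hV.mem_eigenspace_pq hw'), rfl⟩))
        (N.smul_mem _ ⟨w, hw, rfl⟩)

end IsSimpleAction

end Operators

/-! ### The classification -/

/-- The linear map on `N ⊗ ℂ[x, x⁻¹]` that maps `v ⊗ x ^ i` to `g i v`. -/
def NMod.lift (zdot hdot : ℂ) {N M : Type*} [AddCommGroup N] [Module ℂ N] [AddCommGroup M]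
    [Module ℂ M] (g : ℤ → N →ₗ[ℂ] M) : NMod zdot hdot N →ₗ[ℂ] M :=
  TensorProduct.lift (LinearMap.flip ((AddMonoidAlgebra.basis ℤ ℂ).constr ℂ g))

theorem NMod.lift_ι (zdot hdot : ℂ) {N M : Type*} [AddCommGroup N] [Module ℂ N] [AddCommGroup M]
    [Module ℂ M] (g : ℤ → N →ₗ[ℂ] M) (i : ℤ) (v : N) :
    NMod.lift zdot hdot g (ι zdot hdot N i v) = g i v :=
  congrArg (fun f : N →ₗ[ℂ] M => f v) ((AddMonoidAlgebra.basis ℤ ℂ).constr_basis ℂ g i)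

/-! ### The action on integer powers of an invertible q. -/

namespace IsSimpleAction

variable {V : Type*} [AddCommGroup V] [Module ℂ V] {E H P : Module.End ℂ V}
  {w : (Module.End ℂ V)ˣ} {c : ℂ}

/-- The action of `p` on `q ^ i v`, for an integer `i`. -/
theorem p_zpow_apply (hV : IsSimpleAction E H P w c) (i : ℤ) (v : V) :
    P ((w ^ i).1 v) = (w ^ (i - 1)).1 (P (w.1 v) + ((i - 1) * c) • v) := by
  have := congrArg (fun f : Module.End ℂ V => f v) (hV.isShift.zpow (i - 1)).1
  simp only [Module.End.mul_apply, LinearMap.add_apply, LinearMap.smul_apply] at this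
  rw [map_add, map_smul]
  push_cast at this
  rw [← this, ← Module.End.mul_apply w.1, ← Units.val_mul, ← zpow_one_add]
  congr 4
  ring

/-- The action of `e` on `q ^ i v`, for an integer `i`. -/
theorem e_zpow_apply (hV : IsSimpleAction E H P w c) (i : ℤ) (v : V) :
    E ((w ^ i).1 v) = (w ^ (i - 2)).1 (E (w.1 (w.1 v)) + ((i : ℂ) - 2) • P (w.1 v) +
      (((i : ℂ) - 1) * (i - 2) / 2 * c) • v) := by
  have := congrArg (fun f : Module.End ℂ V => f v) (hV.isShift.zpow (i - 2)).2
  simp only [Module.End.mul_apply, LinearMap.add_apply, LinearMap.smul_apply] at this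
  rw [map_add, map_add, map_smul, map_smul]
  push_cast at this
  rw [show ((i : ℂ) - 1) * (i - 2) / 2 * c = ((i : ℂ) - 2) * (i - 2 + 1) / 2 * c by ring, ← this,
    ← Module.End.mul_apply w.1, ← Module.End.mul_apply (w.1 * w.1), ← Units.val_mul,
    ← Units.val_mul, mul_assoc, ← zpow_one_add, ← zpow_one_add]
  congr 4
  ring

theorem h_zpow_apply (hV : IsSimpleAction E H P w c) {μ : ℂ} {v : V} (hv : H v = μ • v) (i : ℤ) :
    H ((w ^ i).1 v) = (μ - i) • (w ^ i).1 v := by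
  induction i using Int.induction_on with
  | zero => simpa using hv
  | succ n ih =>
    rw [add_comm, zpow_one_add, Units.val_mul, Module.End.mul_apply, hV.mem_eigenspace_q ih]
    congr 1; push_cast; ring
  | pred n ih =>
    set x := (w ^ (-(n : ℤ) - 1)).1 v with hx
    have hwx : (w ^ (-(n : ℤ))).1 v = w.1 x := by
      rw [hx, ← Module.End.mul_apply, ← Units.val_mul, ← zpow_one_add]
      congr 4; ring
    rw [hwx] at ih
    have := congrArg (fun f : Module.End ℂ V => f x) hV.hq
    simp only [Module.End.mul_apply, LinearMap.sub_apply, ih] at this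
    -- For the downward step the eigenvalue of x is found after applying q, which can be cancelled.
    have hinj : Function.Injective w.1 := ((Module.End.isUnit_iff _).1 w.isUnit).1
    apply hinj
    rw [eq_add_of_sub_eq this.symm, map_smul]
    push_cast
    module

theorem q_zpow_apply (w : (Module.End ℂ V)ˣ) (i : ℤ) (v : V) :
    w.1 ((w ^ i).1 v) = (w ^ (i + 1)).1 v := by
  rw [add_comm, zpow_one_add]
  rfl

end IsSimpleAction

/-! ### Identification of V from one of its weight spaces. -/

section Classification

variable {V : Type u} [AddCommGroup V] [Module ℂ V] [LieRingModule Ageing V]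
  [LieModule ℂ Ageing V]

/-- Diagonalizability supplies an eigenvector of z, and its eigenspace is a submodule because z is
central; Schur's lemma in a countable-dimensional form is not needed. -/
theorem exists_central_charge [LieModule.IsIrreducible ℂ Ageing V] (hw : IsWeightModule V) :
    ∃ c : ℂ, ∀ v : V, ⁅z, v⁆ = c • v := by
  have : Nontrivial V := LieModule.nontrivial_of_isIrreducible ℂ Ageing V
  have hz : (z : Ageing) ∈ cartan := Submodule.subset_span (by simp)
  obtain ⟨v, -, hv0, c, hc⟩ := exists_eigenvector_mem (LieModule.toEnd ℂ Ageing V z) (hw z hz) ⊤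
    (fun _ _ => trivial) top_ne_bot
  have hmem {a : Ageing} (v : V) (hv : v ∈ (LieModule.toEnd ℂ Ageing V z).eigenspace c) :
      ⁅a, v⁆ ∈ (LieModule.toEnd ℂ Ageing V z).eigenspace c := by
    rw [Module.End.mem_eigenspace_iff, LieModule.toEnd_apply_apply] at hv ⊢
    rw [leibniz_lie, lie_z, zero_lie, zero_add, hv, lie_smul]
  have htop := (eq_bot_or_eq_top_of_stable ((LieModule.toEnd ℂ Ageing V z).eigenspace c) hmem hmem
    hmem hmem hmem).resolve_left fun h =>
      hv0 ((Submodule.mem_bot ℂ).1 (h ▸ Module.End.mem_eigenspace_iff.2 hc))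
  exact ⟨c, fun v => Module.End.mem_eigenspace_iff.1 (htop ▸ trivial :
    v ∈ (LieModule.toEnd ℂ Ageing V z).eigenspace c)⟩

theorem isSimpleAction_toEnd [LieModule.IsIrreducible ℂ Ageing V] {c : ℂ}
    (hc : ∀ v : V, ⁅z, v⁆ = c • v) :
    IsSimpleAction (LieModule.toEnd ℂ Ageing V e) (LieModule.toEnd ℂ Ageing V h)
      (LieModule.toEnd ℂ Ageing V p) (LieModule.toEnd ℂ Ageing V q) c where
  he := LinearMap.ext fun v => by simp [leibniz_lie h e v, lie_h_e, add_comm]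
  hp := LinearMap.ext fun v => by simp [leibniz_lie h p v, lie_h_p, add_comm]
  hq := LinearMap.ext fun v => by simp [leibniz_lie h q v, lie_h_q, sub_eq_add_neg, add_comm]
  eq := LinearMap.ext fun v => by simp [leibniz_lie e q v, lie_e_q, add_comm]
  ep := LinearMap.ext fun v => by simp [leibniz_lie e p v, lie_e_p]
  pq := LinearMap.ext fun v => by simp [leibniz_lie p q v, lie_p_q, hc, add_comm]
  simple S he hh hp hq :=
    eq_bot_or_eq_top_of_stable S he hh hp hq fun v hv => by rw [hc]; exact S.smul_mem c hv

theorem lieSpan_eq_top {V : Type*} [AddCommGroup V] [Module ℂ V] [LieRingModule Ageing V]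
    [LieModule.IsIrreducible ℂ Ageing V] {v : V} (hv : v ≠ 0) :
    LieSubmodule.lieSpan ℂ Ageing {v} = ⊤ := by
  have hmem : v ∈ LieSubmodule.lieSpan ℂ Ageing {v} :=
    LieSubmodule.subset_lieSpan (Set.mem_singleton v)
  refine (IsSimpleOrder.eq_bot_or_eq_top _).resolve_left fun h => hv ?_
  rwa [h, LieSubmodule.mem_bot] at hmem

theorem classification [LieModule.IsIrreducible ℂ Ageing V] (hw : IsWeightModule V)
    (hhigh : ¬ IsHighestWeightModule V) (hlow : ¬ IsLowestWeightModule V) :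
    (∃ lam hdot : ℂ, lam ≠ 0 ∧ Nonempty (V ≃ₗ⁅ℂ,Ageing⁆ Q lam hdot)) ∨
    (∃ zdot hdot lam : ℂ, zdot ≠ 0 ∧ (∀ n : ℤ, lam ≠ n) ∧
      Nonempty (V ≃ₗ⁅ℂ,Ageing⁆ Q' zdot hdot lam)) ∨
    (∃ (zdot hdot : ℂ) (N : Type u) (_ : AddCommGroup N) (_ : Module ℂ N)
      (_ : Module (R zdot) N) (_ : IsScalarTower ℂ (R zdot) N),
      IsSimpleModule (R zdot) N ∧ ¬ FiniteDimensional ℂ N ∧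
      Nonempty (V ≃ₗ⁅ℂ,Ageing⁆ NMod zdot hdot N)) := by
  have hnt : Nontrivial V := LieModule.nontrivial_of_isIrreducible ℂ Ageing V
  obtain ⟨c, hc⟩ := exists_central_charge hw
  have hV := isSimpleAction_toEnd hc
  set E := LieModule.toEnd ℂ Ageing V e with hE
  set H := LieModule.toEnd ℂ Ageing V h with hH
  set P := LieModule.toEnd ℂ Ageing V p with hP
  set Q₀ := LieModule.toEnd ℂ Ageing V q with hQ₀
  have hdiag : ⨆ μ : ℂ, H.eigenspace μ = ⊤ := hw h (Submodule.subset_span (by simp))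
  have hinj : Function.Injective Q₀ := by
    rw [← LinearMap.ker_eq_bot]
    by_contra hker
    obtain ⟨v, hv, hv0, μ, hμ⟩ := exists_eigenvector_mem H hdiag (LinearMap.ker Q₀) (fun v hv => by
      have := congrArg (fun f : Module.End ℂ V => f v) hV.hq
      rw [LinearMap.mem_ker] at hv ⊢
      simpa [hv] using this.symm) hker
    exact hlow ⟨v, μ, c, hv0, hμ, hc v, hv, lieSpan_eq_top hv0⟩
  have hhw (μ : ℂ) (v : V) (hv : H v = μ • v) (hEv : E v = 0) (hPv : P v = 0) : v = 0 := by
    by_contra hv0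
    exact hhigh ⟨v, μ, c, hv0, hv, hc v, hEv, hPv, lieSpan_eq_top hv0⟩
  obtain ⟨w, hwQ⟩ : IsUnit Q₀ :=
    (Module.End.isUnit_iff _).2 ⟨hinj, hV.surjective_q hdiag hinj hhw⟩
  rw [← hwQ] at hV hinj
  have hq (v : V) : ⁅q, v⁆ = w.1 v := by rw [hwQ]; rfl
  obtain ⟨v₀, -, hv₀, μ, hμ⟩ := exists_eigenvector_mem H hdiag ⊤ (fun _ _ => trivial) top_ne_bot
  let N := H.eigenspace μ
  have hN {v : V} (hv : v ∈ N) : H v = μ • v := Module.End.mem_eigenspace_iff.1 hv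
  have hNnt : Nontrivial N := ⟨⟨⟨v₀, Module.End.mem_eigenspace_iff.2 hμ⟩, 0,
    fun h => hv₀ (congrArg Subtype.val h)⟩⟩
  let X : Module.End ℂ N := LinearMap.restrict (P * w.1) (p := N) (q := N) fun v hv =>
    Module.End.mem_eigenspace_iff.2 (hV.mem_eigenspace_pq (hN hv))
  let Y : Module.End ℂ N := LinearMap.restrict (E * w.1 * w.1) (p := N) (q := N) fun v hv =>
    Module.End.mem_eigenspace_iff.2 (hV.mem_eigenspace_eqq (hN hv))
  obtain ⟨f, hfX, hfY⟩ := exists_algHom_phi c X Y (LinearMap.ext fun v => Subtype.ext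
    (congrArg (fun f : Module.End ℂ V => f v) hV.relation))
  have hsimple : IsSimplePair (f (tR c)) (f (thetaR c)) := by
    intro S h1 h2
    obtain ⟨hSX, hSY⟩ := (phiPQ_mem_iff c f S).2 ⟨h1, h2⟩
    rw [hfX] at hSX
    rw [hfY] at hSY
    -- An R_c-stable subspace of N is stable under pq and eq² in V, so `eq_eigenspace` applies to
    -- it.
    refine or_iff_not_imp_left.2 fun hS => ?_
    have := hV.eq_eigenspace hinj μ (S.map N.subtype) (Submodule.map_subtype_le N S)
      (fun h => hS ?_) ?_ ?_
    · refine top_le_iff.1 fun v _ => ?_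
      have hv : (v : V) ∈ S.map N.subtype := this ▸ v.2
      obtain ⟨v', hv', hvv⟩ := hv
      rwa [← Subtype.ext (a1 := v') (a2 := v) hvv]
    · refine S.eq_bot_iff.2 fun v hv => Subtype.ext ?_
      have : (v : V) ∈ S.map N.subtype := ⟨v, hv, rfl⟩
      rwa [h, Submodule.mem_bot] at this
    · rintro _ ⟨v, hv, rfl⟩
      exact ⟨X v, hSX v hv, rfl⟩
    · rintro _ ⟨v, hv, rfl⟩
      exact ⟨Y v, hSY v hv, rfl⟩
  by_cases hfin : FiniteDimensional ℂ N
  · have hT : f (tR c) = 0 := by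
      refine hsimple.eq_zero_of_finiteDimensional (k := relExp c)
        (by unfold relExp; split_ifs <;> simp) ?_
      have := congrArg f (thetaR_mul_tR_eq c)
      rwa [map_mul, map_add, map_mul, map_pow] at this
    obtain ⟨v, hv0, d, hd, -⟩ := hsimple.exists_span_singleton hT
    have hv0' : (v : V) ≠ 0 := fun h => hv0 (Subtype.ext h)
    let x (i : ℤ) : V := (w ^ i).1 v
    have hx0 (i : ℤ) : x i ≠ 0 := fun h => hv0' (by
      have : ((w ^ i)⁻¹ : (Module.End ℂ V)ˣ).1 (x i) = v := by
        change (((w ^ i)⁻¹ : (Module.End ℂ V)ˣ).1 * (w ^ i).1) v = v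
        rw [Units.inv_mul]; rfl
      rw [← this, h, map_zero])
    have hxh (i : ℤ) : ⁅h, x i⁆ = (μ - i) • x i := hV.h_zpow_apply (hN v.2) i
    have hxq (i : ℤ) : ⁅q, x i⁆ = x (i + 1) := by
      rw [hq]; exact IsSimpleAction.q_zpow_apply w i v
    have hxp (i : ℤ) : ⁅p, x i⁆ = (w ^ (i - 1)).1 (X v + ((i - 1) * c) • v : N) :=
      hV.p_zpow_apply i v
    have hxe (i : ℤ) : ⁅e, x i⁆ = (w ^ (i - 2)).1 (Y v + ((i : ℂ) - 2) • X v +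
        (((i : ℂ) - 1) * (i - 2) / 2 * c) • v : N) := hV.e_zpow_apply i v
    by_cases hc0 : c = 0
    · left
      have hX : X v = 0 := by
        rw [← hfX, phiPQ, if_pos hc0, hT]; rfl
      have hY : Y v = d • v := by
        rw [← hfY, phiEQQ, if_pos hc0, hd]; rfl
      have hxp' (i : ℤ) : ⁅p, x i⁆ = 0 := by rw [hxp, hX, hc0]; simp
      have hxe' (i : ℤ) : ⁅e, x i⁆ = d • x (i - 2) := by rw [hxe, hX, hY, hc0]; simp [x]
      -- Otherwise x 0 would be killed by e and p, that is, a highest weight vector.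
      have hd0 : d ≠ 0 := fun hd0 =>
        hx0 0 (hhw _ _ (hxh 0) ((hxe' 0).trans (by rw [hd0, zero_smul])) (hxp' 0))
      have := Q.isIrreducible d μ hd0
      let F : Q d μ →ₗ[ℂ] V := (AddMonoidAlgebra.basis ℤ ℂ).constr ℂ x
      have hF (i : ℤ) : F (Q.x d μ i) = x i := (AddMonoidAlgebra.basis ℤ ℂ).constr_basis ℂ x i
      have hext (a : Ageing) (ha : ∀ i, F ⁅a, Q.x d μ i⁆ = ⁅a, F (Q.x d μ i)⁆) (y : Q d μ) :
          F ⁅a, y⁆ = ⁅a, F y⁆ := by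
        have : F ∘ₗ LieModule.toEnd ℂ Ageing (Q d μ) a = LieModule.toEnd ℂ Ageing V a ∘ₗ F :=
          laurent_ext ha
        exact congrArg (fun g : Q d μ →ₗ[ℂ] V => g y) this
      refine ⟨d, μ, hd0, nonempty_equiv_of_commutes F (fun h => hx0 0 ?_) (hext _ fun i => ?_)
        (hext _ fun i => ?_) (hext _ fun i => ?_) (hext _ fun i => ?_) (hext _ fun i => ?_)⟩
      · rw [← hF, h]; rfl
      · rw [Q.lie_e_x, map_smul, hF, hF, hxe']
      · rw [Q.lie_h_x, map_smul, hF, hxh]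
      · rw [Q.lie_p_x, map_zero, hF, hxp']
      · rw [Q.lie_q_x, hF, hF, hxq]
      · rw [Q.lie_z_x, map_zero, hc, hc0, zero_smul]
    · right; left
      have hX : X v = (2 * c * d) • v := by
        rw [← hfX, phiPQ, if_neg hc0, map_smul, hd, smul_smul]; rfl
      have hY : Y v = (c * d + 2 * c * d ^ 2) • v := by
        rw [← hfY, phiEQQ, if_neg hc0]
        simp only [map_add, map_smul, map_mul, hd, hT, pow_two, LinearMap.add_apply,
          LinearMap.smul_apply, Module.End.mul_apply, Module.End.one_apply, LinearMap.zero_apply]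
        module
      -- The parameter is λ = 2d - 1: pq acts on v by 2cd, and moving p past q^(i-1) adds (i - 1)c.
      have hxp' (i : ℤ) : ⁅p, x i⁆ = (c * (2 * d - 1 + i)) • x (i - 1) := by
        rw [hxp, hX, ← add_smul, Submodule.coe_smul, map_smul]
        congr 1; ring
      have hxe' (i : ℤ) :
          ⁅e, x i⁆ = (c / 2 * (2 * d - 1 + i) * (2 * d - 1 + i - 1)) • x (i - 2) := by
        rw [hxe, hX, hY, smul_smul, ← add_smul, ← add_smul, Submodule.coe_smul, map_smul]
        congr 1; ring
      -- If λ were an integer n, both coefficients would vanish at i = -n and x (-n) would be a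
      -- highest weight vector.
      have hlam (n : ℤ) : 2 * d - 1 ≠ n := fun hn => hx0 (-n) (hhw _ _ (hxh (-n))
        ((hxe' (-n)).trans (by rw [hn]; simp)) ((hxp' (-n)).trans (by rw [hn]; simp)))
      have := Q'.isIrreducible c μ (2 * d - 1) hc0 hlam
      let F : Q' c μ (2 * d - 1) →ₗ[ℂ] V := (AddMonoidAlgebra.basis ℤ ℂ).constr ℂ x
      have hF (i : ℤ) : F (Q'.x c μ (2 * d - 1) i) = x i :=
        (AddMonoidAlgebra.basis ℤ ℂ).constr_basis ℂ x i
      have hext (a : Ageing) (ha : ∀ i, F ⁅a, Q'.x c μ (2 * d - 1) i⁆ =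
          ⁅a, F (Q'.x c μ (2 * d - 1) i)⁆) (y : Q' c μ (2 * d - 1)) : F ⁅a, y⁆ = ⁅a, F y⁆ := by
        have : F ∘ₗ LieModule.toEnd ℂ Ageing (Q' c μ (2 * d - 1)) a =
            LieModule.toEnd ℂ Ageing V a ∘ₗ F := laurent_ext ha
        exact congrArg (fun g : Q' c μ (2 * d - 1) →ₗ[ℂ] V => g y) this
      refine ⟨c, μ, 2 * d - 1, hc0, hlam, nonempty_equiv_of_commutes F (fun h => hx0 0 ?_)
        (hext _ fun i => ?_) (hext _ fun i => ?_) (hext _ fun i => ?_) (hext _ fun i => ?_)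
        (hext _ fun i => ?_)⟩
      · rw [← hF, h]; rfl
      · rw [Q'.lie_e_x, map_smul, hF, hF, hxe']
      · rw [Q'.lie_h_x, map_smul, hF, hxh]
      · rw [Q'.lie_p_x, map_smul, hF, hF, hxp']
      · rw [Q'.lie_q_x, hF, hF, hxq]
      · rw [Q'.lie_z_x, map_smul, hc]
  · right; right
    let _ : Module (R c) N := Module.compHom N f.toRingHom
    have hsmul (r : R c) (v : N) : r • v = f r v := rfl
    have : IsScalarTower ℂ (R c) N := ⟨fun a r v => by rw [hsmul, hsmul, map_smul]; rfl⟩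
    have hact (r : R c) : NMod.act c N r = f r := rfl
    have hs : IsSimpleModule (R c) N := isSimpleModule_of_isSimplePair c N hsimple
    have := NMod.isIrreducible c μ N hfin
    -- The map v ⊗ x^i ↦ q^i v is defined for negative i because q is invertible. Both modules are
    -- simple, so it only has to be nonzero and equivariant.
    let F : NMod c μ N →ₗ[ℂ] V := NMod.lift c μ fun i => (w ^ i).1 ∘ₗ N.subtype
    have hF (i : ℤ) (v : N) : F (NMod.ι c μ N i v) = (w ^ i).1 v := NMod.lift_ι _ _ _ i v
    have hext (a : Ageing) (ha : ∀ i v, F ⁅a, NMod.ι c μ N i v⁆ = ⁅a, F (NMod.ι c μ N i v)⁆)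
        (y : NMod c μ N) : F ⁅a, y⁆ = ⁅a, F y⁆ := by
      have : F ∘ₗ LieModule.toEnd ℂ Ageing (NMod c μ N) a = LieModule.toEnd ℂ Ageing V a ∘ₗ F :=
        NMod.hom_ext c μ ha
      exact congrArg (fun g : NMod c μ N →ₗ[ℂ] V => g y) this
    refine ⟨c, μ, N, inferInstance, inferInstance, inferInstance, inferInstance, hs, hfin,
      nonempty_equiv_of_commutes F (fun h => hv₀ ?_) (hext _ fun i v => ?_)
        (hext _ fun i v => ?_) (hext _ fun i v => ?_) (hext _ fun i v => ?_)
        (hext _ fun i v => ?_)⟩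
    · have := hF 0 ⟨v₀, Module.End.mem_eigenspace_iff.2 hμ⟩
      rw [h] at this
      simpa using this.symm
    · rw [NMod.lie_e_ι, hF, hF, NMod.coeffE, hact, hact, hfX, hfY]
      exact (hV.e_zpow_apply i v).symm
    · rw [NMod.lie_h_ι, map_smul, hF]
      exact (hV.h_zpow_apply (hN v.2) i).symm
    · rw [NMod.lie_p_ι, hF, hF, NMod.coeffP, hact, hfX]
      exact (hV.p_zpow_apply i v).symm
    · rw [NMod.lie_q_ι, hF, hF, hq, IsSimpleAction.q_zpow_apply]
    · rw [NMod.lie_z_ι, map_smul, hF, hc]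

end Classification

end Ageing

end

theorem theorem1 :
    (∀ (V : Type u) [AddCommGroup V] [Module ℂ V] [LieRingModule Ageing V]
      [LieModule ℂ Ageing V],
      LieModule.IsIrreducible ℂ Ageing V → Ageing.IsWeightModule V →
        (Ageing.IsHighestWeightModule V ∨ Ageing.IsLowestWeightModule V) ∨
        (∃ lam hdot : ℂ, lam ≠ 0 ∧ Nonempty (V ≃ₗ⁅ℂ,Ageing⁆ Ageing.Q lam hdot)) ∨
        (∃ zdot hdot lam : ℂ, zdot ≠ 0 ∧ (∀ n : ℤ, lam ≠ n) ∧
          Nonempty (V ≃ₗ⁅ℂ,Ageing⁆ Ageing.Q' zdot hdot lam)) ∨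
        (∃ (zdot hdot : ℂ) (N : Type u) (_ : AddCommGroup N) (_ : Module ℂ N)
          (_ : Module (Ageing.R zdot) N) (_ : IsScalarTower ℂ (Ageing.R zdot) N),
          IsSimpleModule (Ageing.R zdot) N ∧ ¬ FiniteDimensional ℂ N ∧
          Nonempty (V ≃ₗ⁅ℂ,Ageing⁆ Ageing.NMod zdot hdot N))) ∧
    (∀ lam hdot : ℂ, lam ≠ 0 →
      LieModule.IsIrreducible ℂ Ageing (Ageing.Q lam hdot) ∧
        Ageing.IsWeightModule (Ageing.Q lam hdot)) ∧
    (∀ zdot hdot lam : ℂ, zdot ≠ 0 → (∀ n : ℤ, lam ≠ n) →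
      LieModule.IsIrreducible ℂ Ageing (Ageing.Q' zdot hdot lam) ∧
        Ageing.IsWeightModule (Ageing.Q' zdot hdot lam)) ∧
    (∀ (zdot hdot : ℂ) (N : Type u) [AddCommGroup N] [Module ℂ N] [Module (Ageing.R zdot) N]
      [IsScalarTower ℂ (Ageing.R zdot) N],
      IsSimpleModule (Ageing.R zdot) N → ¬ FiniteDimensional ℂ N →
      LieModule.IsIrreducible ℂ Ageing (Ageing.NMod zdot hdot N) ∧
        Ageing.IsWeightModule (Ageing.NMod zdot hdot N)) := by
  refine ⟨fun V _ _ _ _ hV hw => ?_, fun lam hdot hlam => ?_, fun zdot hdot lam hz hlam => ?_,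
    fun zdot hdot N _ _ _ _ hs hfin => ?_⟩
  · by_cases hhigh : Ageing.IsHighestWeightModule V
    · exact Or.inl (Or.inl hhigh)
    by_cases hlow : Ageing.IsLowestWeightModule V
    · exact Or.inl (Or.inr hlow)
    exact Or.inr (Ageing.classification hw hhigh hlow)
  · exact ⟨Ageing.Q.isIrreducible lam hdot hlam, Ageing.Q.isWeightModule lam hdot⟩
  · exact ⟨Ageing.Q'.isIrreducible zdot hdot lam hz hlam, Ageing.Q'.isWeightModule zdot hdot lam⟩
  · exact ⟨Ageing.NMod.isIrreducible zdot hdot N hfin, Ageing.NMod.isWeightModule zdot hdot N⟩
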